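/- Let $X$ be a paracompact smooth Hausdorff manifold of dimension $n$, and let $I=(0,1]$. Let $\widetilde{\mathbb R}=\mathcal E_M/\mathcal N$ be the ring of generalized numbers: nets $(a_\varepsilon)_{\varepsilon\in I}$ of reals with $|a_\varepsilon|=O(\varepsilon^{m})$ as $\varepsilon\to0$ for some $m\in\mathbb Z$ (moderate), modulo those for which this holds for all $m$ (negligible). Write $a>0$ if $a$ has a representative with $a_\varepsilon\ge\varepsilon^m$ for some $m\ge 0$ and all small $\varepsilon$, and $a<0$ if $-a>0$. Let $\mathcal G(X)$, $\mathcal G^1_0(X)$, $\mathcal G^0_2(X)$ be the spaces of generalized functions, vector fields and $(0,2)$-tensor fields on $X$: moderate nets of smooth objects modulo negligible ones, where a net is moderate (negligible) if in every chart, on every compact subset of the chart's image, the derivatives of each order of its local expression are $O(\varepsilon^{-N})$ for some $N$ (are $O(\varepsilon^m)$ for all $m$). For $f\in\mathcal G(X)$ write $f>0$ if $f$ is invertible in $\mathcal G(X)$ and for each compact $K\subseteq X$ has a representative that is nonnegative on $K$, and $f<0$ if $-f>0$. For open $\Omega\subseteq\mathbb R^n$, $\widetilde\Omega_c$ denotes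 the set of compactly supported generalized points: nets in $\Omega$ that lie in some fixed compact subset of $\Omega$ for all small $\varepsilon$, modulo $|x_\varepsilon-y_\varepsilon|=O(\varepsilon^m)$ for all $m$. For a chart $(V_\alpha,\psi_\alpha)$ and $\widetilde x\in(\psi_\alpha(V_\alpha))^\sim_c$, the point values of the local expressions are $\xi_\alpha(\widetilde x)\in\widetilde{\mathbb R}^n$ and the bilinear form $g_\alpha(\widetilde x)$ on $\widetilde{\mathbb R}^n$. A symmetric bilinear form on $\widetilde{\mathbb R}^n$ has Lorentzian signature if, in some basis, one of the $n$ generalized eigenvalues of its matrix (classes of the ordered eigenvalues of a symmetric representative) is $<0$ and the other $n-1$ are $>0$. For such a form $b$, an element $u\in\widetilde{\mathbb R}^n$ is time-like if $b(u,u)<0$, space-like if $b(u,u)>0$, and null if $u=0$, or $u$ is free (that is, $au=0$ only for $a=0$) and $b(u,u)=0$. Let $g\in\mathcal G^0_2(X)$ be a generalized Lorentzian metric: all point values $g_\alpha(\widetilde x)$ in charts are symmetric and nondegenerate, and for each relatively compact open $V\subseteq X$ there are a representative $(g_\varepsilon)_\varepsilon$ of $g$ and $\varepsilon_0>0$ such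 that $g_\varepsilon|_V$ is a smooth pseudo-Riemannian metric of index $1$ for all $\varepsilon<\varepsilon_0$. Let $\xi\in\mathcal G^1_0(X)$. Theorem. For all charts $(V_\alpha,\psi_\alpha)$ and all $\widetilde x\in(\psi_\alpha(V_\alpha))^\sim_c$, $g_\alpha(\widetilde x)$ is a symmetric bilinear form of Lorentzian signature. Moreover: 1. $\xi_\alpha(\widetilde x)$ is time-like with respect to $g_\alpha(\widetilde x)$ for all charts and all such $\widetilde x$ if and only if $g(\xi,\xi)<0$ in $\mathcal G(X)$. 2. $\xi_\alpha(\widetilde x)$ is space-like with respect to $g_\alpha(\widetilde x)$ for all charts and all such $\widetilde x$ if and only if $g(\xi,\xi)>0$ in $\mathcal G(X)$. 3. $g_\alpha(\widetilde x)(\xi_\alpha(\widetilde x),\xi_\alpha(\widetilde x))=0$ for all charts and all such $\widetilde x$ if and only if $g(\xi,\xi)=0$ in $\mathcal G(X)$; and $\xi_\alpha(\widetilde x)$ is null with respect to $g_\alpha(\widetilde x)$ for all charts and all such $\widetilde x$ if and only if $g(\xi,\xi)=0$ in $\mathcal G(X)$ and, for all charts and all such $\widetilde x$, $\xi_\alpha(\widetilde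 x)$ is zero or free. -/

import Mathlib

open Set Filter Topology Bundle
open scoped Manifold ContDiff

noncomputable section

namespace Colombeau

/-! ### Nets and asymptotic estimates -/

/-- The index set `I = (0,1]`. -/
abbrev Eps : Type := Set.Ioc (0 : ℝ) 1

/-- The filter `ε → 0` on `I`. -/
def epsZero : Filter Eps := comap (fun ε : Eps => (ε : ℝ)) (𝓝 0)

/-- `|a_ε| = O(ε^p)` as `ε → 0`. -/
def OEps (a : Eps → ℝ) (p : ℤ) : Prop :=
  ∃ C : ℝ, ∀ᶠ ε in epsZero, |a ε| ≤ C * (ε : ℝ) ^ p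

/-- Moderate nets of real numbers. -/
def ModerateNum (a : Eps → ℝ) : Prop := ∃ p : ℤ, OEps a p

/-- Negligible nets of real numbers. -/
def NegligibleNum (a : Eps → ℝ) : Prop := ∀ p : ℤ, OEps a p

section NetsOnOpenSets

variable {E F G : Type*} [NormedAddCommGroup E] [NormedSpace ℝ E]
  [NormedAddCommGroup F] [NormedSpace ℝ F] [NormedAddCommGroup G] [NormedSpace ℝ G]

/-- `sup_{y ∈ K} ‖D^k u_ε(y)‖ = O(ε^p)` as `ε → 0`. -/
def OOn (K : Set E) (k : ℕ) (p : ℤ) (u : Eps → E → F) : Prop :=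
  ∃ C : ℝ, ∀ᶠ ε in epsZero, ∀ y ∈ K, ‖iteratedFDeriv ℝ k (u ε) y‖ ≤ C * (ε : ℝ) ^ p

/-- A net of functions, smooth on the open set `Ω`, is moderate on `Ω`: on every compact subset of
`Ω`, the derivatives of every order are `O(ε^{-N})` for some `N`. -/
def ModerateOn (Ω : Set E) (u : Eps → E → F) : Prop :=
  ∀ K ⊆ Ω, IsCompact K → ∀ k : ℕ, ∃ p : ℤ, OOn K k p u

/-- A net of functions, smooth on the open set `Ω`, is negligible on `Ω`: on every compact subset
of `Ω`, the derivatives of every order are `O(ε^m)` for all `m`. -/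
def NegligibleOn (Ω : Set E) (u : Eps → E → F) : Prop :=
  ∀ K ⊆ Ω, IsCompact K → ∀ k : ℕ, ∀ p : ℤ, OOn K k p u

lemma zpow_anti (ε : Eps) {p q : ℤ} (h : p ≤ q) : (ε : ℝ) ^ q ≤ (ε : ℝ) ^ p :=
  zpow_le_zpow_right_of_le_one₀ ε.2.1 ε.2.2 h

lemma OOn.mono {K : Set E} {k : ℕ} {p q : ℤ} {u : Eps → E → F} (h : OOn K k q u) (hpq : p ≤ q) :
    OOn K k p u := by
  obtain ⟨C, hC⟩ := h
  refine ⟨|C|, hC.mono fun ε hε y hy => (hε y hy).trans ?_⟩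
  have h1 := zpow_anti ε hpq
  have h2 : 0 < (ε : ℝ) ^ q := zpow_pos ε.2.1 q
  calc C * (ε : ℝ) ^ q ≤ |C| * (ε : ℝ) ^ q := by gcongr; exact le_abs_self C
    _ ≤ |C| * (ε : ℝ) ^ p := by gcongr

lemma OOn.add {K : Set E} {k : ℕ} {p : ℤ} {u v : Eps → E → F} (hu : OOn K k p u)
    (hv : OOn K k p v) (su : ∀ ε, ∀ y ∈ K, ContDiffAt ℝ ∞ (u ε) y)
    (sv : ∀ ε, ∀ y ∈ K, ContDiffAt ℝ ∞ (v ε) y) :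
    OOn K k p (fun ε => u ε + v ε) := by
  obtain ⟨C, hC⟩ := hu
  obtain ⟨D, hD⟩ := hv
  refine ⟨C + D, ?_⟩
  filter_upwards [hC, hD] with ε h1 h2 y hy
  rw [iteratedFDeriv_add_apply ((su ε y hy).of_le (by exact_mod_cast le_top))
    ((sv ε y hy).of_le (by exact_mod_cast le_top)), add_mul]
  exact (norm_add_le _ _).trans (add_le_add (h1 y hy) (h2 y hy))

lemma OOn.const_smul {K : Set E} {k : ℕ} {p : ℤ} {u : Eps → E → F} (hu : OOn K k p u) (c : ℝ)
    (su : ∀ ε, ∀ y ∈ K, ContDiffAt ℝ ∞ (u ε) y) : OOn K k p (fun ε => c • u ε) := by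
  obtain ⟨C, hC⟩ := hu
  refine ⟨|c| * C, ?_⟩
  filter_upwards [hC] with ε h1 y hy
  rw [iteratedFDeriv_const_smul_apply ((su ε y hy).of_le (by exact_mod_cast le_top)), norm_smul,
    mul_assoc, Real.norm_eq_abs]
  exact mul_le_mul_of_nonneg_left (h1 y hy) (abs_nonneg c)

lemma OOn.zero (K : Set E) (k : ℕ) (p : ℤ) : OOn K k p (fun _ => (0 : E → F)) := by
  refine ⟨0, Eventually.of_forall fun ε y _ => ?_⟩
  simp [Pi.zero_def]

lemma OOn.bilin {K : Set E} {k : ℕ} {p q : ℤ} {u : Eps → E → F} {H : Type*}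
    [NormedAddCommGroup H] [NormedSpace ℝ H] {v : Eps → E → G}
    (B : F →L[ℝ] G →L[ℝ] H) {Ω : Set E} (hΩ : IsOpen Ω) (hK : K ⊆ Ω)
    (hu : ∀ i ≤ k, OOn K i p u) (hv : ∀ i ≤ k, OOn K i q v)
    (su : ∀ ε, ContDiffOn ℝ ∞ (u ε) Ω) (sv : ∀ ε, ContDiffOn ℝ ∞ (v ε) Ω) :
    OOn K k (p + q) (fun ε y => B (u ε y) (v ε y)) := by
  choose! C hC using hu
  choose! D hD using hv
  have hC' : ∀ᶠ ε in epsZero, ∀ i ∈ Finset.range (k + 1), ∀ y ∈ K,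
      ‖iteratedFDeriv ℝ i (u ε) y‖ ≤ C i * (ε : ℝ) ^ p :=
    (Filter.eventually_all_finset _).2 fun i hi => hC i (by simpa [Nat.lt_succ_iff] using hi)
  have hD' : ∀ᶠ ε in epsZero, ∀ i ∈ Finset.range (k + 1), ∀ y ∈ K,
      ‖iteratedFDeriv ℝ i (v ε) y‖ ≤ D i * (ε : ℝ) ^ q :=
    (Filter.eventually_all_finset _).2 fun i hi => hD i (by simpa [Nat.lt_succ_iff] using hi)
  refine ⟨‖B‖ * ∑ i ∈ Finset.range (k + 1), (k.choose i : ℝ) * |C i| * |D (k - i)|, ?_⟩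
  filter_upwards [hC', hD'] with ε h1 h2 y hy
  have hyΩ := hK hy
  have key := B.norm_iteratedFDerivWithin_le_of_bilinear (su ε) (sv ε) hΩ.uniqueDiffOn hyΩ
    (n := k) (by exact_mod_cast le_top)
  simp only [iteratedFDerivWithin_of_isOpen _ hΩ hyΩ] at key
  refine key.trans ?_
  rw [mul_assoc, Finset.sum_mul]
  refine mul_le_mul_of_nonneg_left (Finset.sum_le_sum fun i hi => ?_) (norm_nonneg B)
  have hik : i ≤ k := by simpa [Nat.lt_succ_iff] using hi
  have hεp : 0 < (ε : ℝ) ^ p := zpow_pos ε.2.1 p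
  have hεq : 0 < (ε : ℝ) ^ q := zpow_pos ε.2.1 q
  have a1 : ‖iteratedFDeriv ℝ i (u ε) y‖ ≤ |C i| * (ε : ℝ) ^ p :=
    (h1 i hi y hy).trans (by gcongr; exact le_abs_self _)
  have a2 : ‖iteratedFDeriv ℝ (k - i) (v ε) y‖ ≤ |D (k - i)| * (ε : ℝ) ^ q :=
    (h2 (k - i) (by simp) y hy).trans (by gcongr; exact le_abs_self _)
  calc (k.choose i : ℝ) * ‖iteratedFDeriv ℝ i (u ε) y‖ * ‖iteratedFDeriv ℝ (k - i) (v ε) y‖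
      ≤ (k.choose i : ℝ) * (|C i| * (ε : ℝ) ^ p) * (|D (k - i)| * (ε : ℝ) ^ q) := by gcongr
    _ = (k.choose i : ℝ) * |C i| * |D (k - i)| * (ε : ℝ) ^ (p + q) := by
        rw [zpow_add₀ ε.2.1.ne']; ring

lemma ModerateOn.unif {Ω K : Set E} {u : Eps → E → F} (hu : ModerateOn Ω u) (hK : K ⊆ Ω)
    (hc : IsCompact K) (k : ℕ) : ∃ p : ℤ, ∀ i ≤ k, OOn K i p u := by
  induction k with
  | zero =>
    obtain ⟨p, hp⟩ := hu K hK hc 0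
    exact ⟨p, fun i hi => by rwa [Nat.le_zero.1 hi]⟩
  | succ k ih =>
    obtain ⟨p, hp⟩ := ih
    obtain ⟨q, hq⟩ := hu K hK hc (k + 1)
    refine ⟨min p q, fun i hi => ?_⟩
    rcases Nat.le_succ_iff.1 hi with h | h
    · exact (hp i h).mono (min_le_left _ _)
    · subst h; exact hq.mono (min_le_right _ _)

lemma NegligibleOn.moderate {Ω : Set E} {u : Eps → E → F} (h : NegligibleOn Ω u) :
    ModerateOn Ω u := fun K hK hc k => ⟨0, h K hK hc k 0⟩

lemma contDiffAt_of_subset {Ω : Set E} (hΩ : IsOpen Ω) {f : E → F} (hf : ContDiffOn ℝ ∞ f Ω)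
    {K : Set E} (hK : K ⊆ Ω) : ∀ y ∈ K, ContDiffAt ℝ ∞ f y :=
  fun _ hy => hf.contDiffAt (hΩ.mem_nhds (hK hy))

lemma ModerateOn.add {Ω : Set E} (hΩ : IsOpen Ω) {u v : Eps → E → F} (hu : ModerateOn Ω u)
    (hv : ModerateOn Ω v) (su : ∀ ε, ContDiffOn ℝ ∞ (u ε) Ω) (sv : ∀ ε, ContDiffOn ℝ ∞ (v ε) Ω) :
    ModerateOn Ω (fun ε => u ε + v ε) := by
  intro K hK hc k
  obtain ⟨p, hp⟩ := hu K hK hc k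
  obtain ⟨q, hq⟩ := hv K hK hc k
  exact ⟨min p q, (hp.mono (min_le_left _ _)).add (hq.mono (min_le_right _ _))
    (fun ε => contDiffAt_of_subset hΩ (su ε) hK) (fun ε => contDiffAt_of_subset hΩ (sv ε) hK)⟩

lemma NegligibleOn.add {Ω : Set E} (hΩ : IsOpen Ω) {u v : Eps → E → F} (hu : NegligibleOn Ω u)
    (hv : NegligibleOn Ω v) (su : ∀ ε, ContDiffOn ℝ ∞ (u ε) Ω)
    (sv : ∀ ε, ContDiffOn ℝ ∞ (v ε) Ω) :
    NegligibleOn Ω (fun ε => u ε + v ε) := fun K hK hc k p =>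
  (hu K hK hc k p).add (hv K hK hc k p)
    (fun ε => contDiffAt_of_subset hΩ (su ε) hK) (fun ε => contDiffAt_of_subset hΩ (sv ε) hK)

lemma ModerateOn.const_smul {Ω : Set E} (hΩ : IsOpen Ω) {u : Eps → E → F} (hu : ModerateOn Ω u)
    (c : ℝ) (su : ∀ ε, ContDiffOn ℝ ∞ (u ε) Ω) : ModerateOn Ω (fun ε => c • u ε) := by
  intro K hK hc k
  obtain ⟨p, hp⟩ := hu K hK hc k
  exact ⟨p, hp.const_smul c (fun ε => contDiffAt_of_subset hΩ (su ε) hK)⟩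

lemma NegligibleOn.const_smul {Ω : Set E} (hΩ : IsOpen Ω) {u : Eps → E → F}
    (hu : NegligibleOn Ω u) (c : ℝ) (su : ∀ ε, ContDiffOn ℝ ∞ (u ε) Ω) :
    NegligibleOn Ω (fun ε => c • u ε) := fun K hK hc k p =>
  (hu K hK hc k p).const_smul c (fun ε => contDiffAt_of_subset hΩ (su ε) hK)

lemma NegligibleOn.zero (Ω : Set E) : NegligibleOn Ω (fun _ => (0 : E → F)) :=
  fun K _ _ k p => OOn.zero K k p

lemma ModerateOn.bilin {H : Type*} [NormedAddCommGroup H] [NormedSpace ℝ H] {Ω : Set E}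
    (hΩ : IsOpen Ω) (B : F →L[ℝ] G →L[ℝ] H) {u : Eps → E → F} {v : Eps → E → G}
    (hu : ModerateOn Ω u) (hv : ModerateOn Ω v)
    (su : ∀ ε, ContDiffOn ℝ ∞ (u ε) Ω) (sv : ∀ ε, ContDiffOn ℝ ∞ (v ε) Ω) :
    ModerateOn Ω (fun ε y => B (u ε y) (v ε y)) := by
  intro K hK hc k
  obtain ⟨p, hp⟩ := hu.unif hK hc k
  obtain ⟨q, hq⟩ := hv.unif hK hc k
  exact ⟨p + q, OOn.bilin B hΩ hK hp hq su sv⟩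

lemma NegligibleOn.bilin_left {H : Type*} [NormedAddCommGroup H] [NormedSpace ℝ H] {Ω : Set E}
    (hΩ : IsOpen Ω) (B : F →L[ℝ] G →L[ℝ] H) {u : Eps → E → F} {v : Eps → E → G}
    (hu : NegligibleOn Ω u) (hv : ModerateOn Ω v)
    (su : ∀ ε, ContDiffOn ℝ ∞ (u ε) Ω) (sv : ∀ ε, ContDiffOn ℝ ∞ (v ε) Ω) :
    NegligibleOn Ω (fun ε y => B (u ε y) (v ε y)) := by
  intro K hK hc k m
  obtain ⟨q, hq⟩ := hv.unif hK hc k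
  have := OOn.bilin B hΩ hK (p := m - q) (fun i _ => hu K hK hc i _) hq su sv
  simpa using this

lemma NegligibleOn.bilin_right {H : Type*} [NormedAddCommGroup H] [NormedSpace ℝ H] {Ω : Set E}
    (hΩ : IsOpen Ω) (B : F →L[ℝ] G →L[ℝ] H) {u : Eps → E → F} {v : Eps → E → G}
    (hu : ModerateOn Ω u) (hv : NegligibleOn Ω v)
    (su : ∀ ε, ContDiffOn ℝ ∞ (u ε) Ω) (sv : ∀ ε, ContDiffOn ℝ ∞ (v ε) Ω) :
    NegligibleOn Ω (fun ε y => B (u ε y) (v ε y)) := by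
  have := NegligibleOn.bilin_left hΩ B.flip hv hu sv su
  simpa using this

lemma ModerateOn.congr {Ω : Set E} (hΩ : IsOpen Ω) {u v : Eps → E → F} (hu : ModerateOn Ω u)
    (h : ∀ ε, EqOn (u ε) (v ε) Ω) : ModerateOn Ω v := by
  intro K hK hc k
  obtain ⟨p, C, hC⟩ := hu K hK hc k
  refine ⟨p, C, hC.mono fun ε h1 y hy => ?_⟩
  rw [← ((h ε).eventuallyEq_of_mem (hΩ.mem_nhds (hK hy))).iteratedFDeriv ℝ k |>.eq_of_nhds]
  exact h1 y hy

lemma NegligibleOn.congr {Ω : Set E} (hΩ : IsOpen Ω) {u v : Eps → E → F} (hu : NegligibleOn Ω u)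
    (h : ∀ ε, EqOn (u ε) (v ε) Ω) : NegligibleOn Ω v := by
  intro K hK hc k p
  obtain ⟨C, hC⟩ := hu K hK hc k p
  refine ⟨C, hC.mono fun ε h1 y hy => ?_⟩
  rw [← ((h ε).eventuallyEq_of_mem (hΩ.mem_nhds (hK hy))).iteratedFDeriv ℝ k |>.eq_of_nhds]
  exact h1 y hy

end NetsOnOpenSets

section Manifold

set_option linter.unusedSectionVars false

variable {n : ℕ} {X : Type*} [TopologicalSpace X] [ChartedSpace (EuclideanSpace ℝ (Fin n)) X]
  [IsManifold (𝓡 n) ∞ X]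

/-- `ℝⁿ`. -/
abbrev Euc (n : ℕ) : Type := EuclideanSpace ℝ (Fin n)

instance instNormedAddCommGroupBilin (n : ℕ) :
    NormedAddCommGroup (Euc n →L[ℝ] Euc n →L[ℝ] ℝ) := ContinuousLinearMap.toNormedAddCommGroup

instance instNormedSpaceBilin (n : ℕ) : NormedSpace ℝ (Euc n →L[ℝ] Euc n →L[ℝ] ℝ) :=
  ContinuousLinearMap.toNormedSpace

variable (n X) in
/-- The charts `(V, ψ)` of the smooth manifold `X`: `V` is `φ.source`, `ψ(V)` is `φ.target`. -/
abbrev Chart : Type _ :=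
  {φ : OpenPartialHomeomorph X (Euc n) // φ ∈ IsManifold.maximalAtlas (𝓡 n) ∞ X}

variable (n X) in
/-- Smooth real functions on `X`. -/
abbrev SmoothFun : Type _ := C^∞⟮𝓡 n, X; 𝓘(ℝ, ℝ), ℝ⟯

variable (n X) in
/-- Smooth vector fields on `X`. -/
abbrev SmoothVF : Type _ :=
  Cₛ^∞⟮𝓡 n; Euc n, fun x : X => TangentSpace (𝓡 n) x⟯

variable (n X) in
/-- Smooth tensor fields of type `(0,2)` on `X`. -/
abbrev SmoothT02 : Type _ :=
  Cₛ^∞⟮𝓡 n; Euc n →L[ℝ] Euc n →L[ℝ] ℝ,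
    fun x : X => TangentSpace (𝓡 n) x →L[ℝ] TangentSpace (𝓡 n) x →L[ℝ] ℝ⟯

instance instContinuousAddCotangent (x : X) : ContinuousAdd (TangentSpace (𝓡 n) x →L[ℝ] ℝ) :=
  inferInstanceAs (ContinuousAdd (Euc n →L[ℝ] ℝ))

instance instAddCommGroupT02 : AddCommGroup (SmoothT02 n X) := ContMDiffSection.instAddCommGroup

instance instModuleT02 : Module ℝ (SmoothT02 n X) := ContMDiffSection.instModule

/-- Local expression `f ∘ ψ⁻¹` of a function. -/
def locFun (φ : Chart n X) (f : SmoothFun n X) : Euc n → ℝ := fun y => f (φ.1.symm y)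

/-- Local expression of a vector field in a chart: `y ↦ dψ(ξ(ψ⁻¹ y))`. -/
def locVF (φ : Chart n X) (ξ : SmoothVF n X) : Euc n → Euc n := fun y =>
  mfderiv (𝓡 n) (𝓡 n) φ.1 (φ.1.symm y) (ξ (φ.1.symm y))

/-- Local expression of a `(0,2)`-tensor field in a chart:
`y ↦ ((v, w) ↦ g(ψ⁻¹ y)(d(ψ⁻¹)_y v, d(ψ⁻¹)_y w))`. -/
def locT02 (φ : Chart n X) (g : SmoothT02 n X) : Euc n → Euc n →L[ℝ] Euc n →L[ℝ] ℝ := fun y =>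
  let A : Euc n →L[ℝ] Euc n := mfderiv (𝓡 n) (𝓡 n) φ.1.symm y
  let b : Euc n →L[ℝ] Euc n →L[ℝ] ℝ := g (φ.1.symm y)
  b.bilinearComp A A

lemma locT02_apply (φ : Chart n X) (g : SmoothT02 n X) (y v w : Euc n) :
    locT02 φ g y v w = g (φ.1.symm y) (mfderiv (𝓡 n) (𝓡 n) φ.1.symm y v)
      (mfderiv (𝓡 n) (𝓡 n) φ.1.symm y w) := rfl

lemma locFun_smooth (φ : Chart n X) (f : SmoothFun n X) :
    ContDiffOn ℝ ∞ (locFun φ f) φ.1.target := by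
  have h := f.contMDiff.comp_contMDiffOn (contMDiffOn_symm_of_mem_maximalAtlas φ.2)
  exact h.contDiffOn

lemma locVF_smooth (φ : Chart n X) (ξ : SmoothVF n X) :
    ContDiffOn ℝ ∞ (locVF φ ξ) φ.1.target := by
  have h1 := contMDiffOn_symm_of_mem_maximalAtlas φ.2
  have h2 := ξ.contMDiff.comp_contMDiffOn h1
  have h3 := (contMDiffOn_of_mem_maximalAtlas φ.2).contMDiffOn_tangentMapWithin (m := ∞)
    le_rfl φ.1.open_source.uniqueMDiffOn
  have h4 := h3.comp h2 (fun y hy => φ.1.map_target hy)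
  have h5 := (contMDiff_snd_tangentBundle_modelSpace (Euc n) (𝓡 n) (n := ∞)).comp_contMDiffOn h4
  refine h5.contDiffOn.congr fun y hy => ?_
  have := mfderivWithin_of_isOpen (I := 𝓡 n) (I' := 𝓡 n) (f := φ.1) φ.1.open_source
    (φ.1.map_target hy)
  exact (DFunLike.congr_fun this (ξ (φ.1.symm y))).symm

lemma locT02_smooth (φ : Chart n X) (g : SmoothT02 n X) :
    ContDiffOn ℝ ∞ (locT02 φ g) φ.1.target := by
  rw [contDiffOn_clm_apply]; intro v
  rw [contDiffOn_clm_apply]; intro w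
  have h1 := contMDiffOn_symm_of_mem_maximalAtlas φ.2
  have h2 := g.contMDiff.comp_contMDiffOn h1
  have h3 := h1.contMDiffOn_tangentMapWithin (m := ∞) le_rfl φ.1.open_target.uniqueMDiffOn
  have hc : ∀ v : Euc n, ContMDiffOn (𝓡 n) (𝓡 n).tangent ∞
      (fun y => (⟨φ.1.symm y, mfderiv (𝓡 n) (𝓡 n) φ.1.symm y v⟩ :
        TangentBundle (𝓡 n) X)) φ.1.target := by
    intro v
    have hv : ContMDiffOn (𝓡 n) (𝓡 n).tangent ∞
        (fun y : Euc n => (⟨y, v⟩ : TangentBundle (𝓡 n) (Euc n))) φ.1.target :=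
      contMDiffOn_vectorSpace_iff_contDiffOn.2 contDiffOn_const
    refine (h3.comp hv (fun y hy => hy)).congr fun y hy => ?_
    have := mfderivWithin_of_isOpen (I := 𝓡 n) (I' := 𝓡 n) (f := φ.1.symm) φ.1.open_target hy
    simp [tangentMapWithin, this]
  have h4 : ContMDiffOn (𝓡 n) ((𝓡 n).prod 𝓘(ℝ)) ∞
      (fun y => TotalSpace.mk' ℝ (E := Bundle.Trivial X ℝ) (φ.1.symm y)
        (g (φ.1.symm y) (mfderiv (𝓡 n) (𝓡 n) φ.1.symm y v)
          (mfderiv (𝓡 n) (𝓡 n) φ.1.symm y w))) φ.1.target := by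
    apply ContMDiffOn.clm_bundle_apply₂ (F₁ := Euc n) (F₂ := Euc n)
    · exact h2
    · exact hc v
    · exact hc w
  intro y hy
  have h5 := h4 y hy
  simp only [contMDiffWithinAt_totalSpace] at h5
  exact h5.2.contDiffWithinAt

lemma locFun_add (φ : Chart n X) (f h : SmoothFun n X) :
    locFun φ (f + h) = locFun φ f + locFun φ h := rfl

lemma locVF_add (φ : Chart n X) (f h : SmoothVF n X) :
    locVF φ (f + h) = locVF φ f + locVF φ h := by
  funext y; exact map_add _ _ _

lemma locVF_smul (φ : Chart n X) (c : ℝ) (f : SmoothVF n X) :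
    locVF φ (c • f) = c • locVF φ f := by
  funext y; exact (mfderiv (𝓡 n) (𝓡 n) φ.1 (φ.1.symm y)).map_smul c (f (φ.1.symm y))

lemma locVF_zero (φ : Chart n X) : locVF φ (0 : SmoothVF n X) = 0 := by
  funext y; exact map_zero _

lemma locT02_add (φ : Chart n X) (f h : SmoothT02 n X) :
    locT02 φ (f + h) = locT02 φ f + locT02 φ h := rfl

lemma locT02_smul (φ : Chart n X) (c : ℝ) (f : SmoothT02 n X) :
    locT02 φ (c • f) = c • locT02 φ f := rfl

lemma locT02_zero (φ : Chart n X) : locT02 φ (0 : SmoothT02 n X) = 0 := rfl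

/-- The smooth function `g(ξ, η)`. -/
def pairFun (g : SmoothT02 n X) (ξ η : SmoothVF n X) : SmoothFun n X :=
  ⟨fun x => g x (ξ x) (η x), by
    have h : ContMDiff (𝓡 n) ((𝓡 n).prod 𝓘(ℝ)) ∞
      (fun x => TotalSpace.mk' ℝ (E := Bundle.Trivial X ℝ) x (g x (ξ x) (η x))) := by
      apply ContMDiff.clm_bundle_apply₂ (F₁ := Euc n) (F₂ := Euc n)
      · exact g.contMDiff
      · exact ξ.contMDiff
      · exact η.contMDiff
    intro x
    have h5 := h x
    simp only [contMDiffAt_totalSpace] at h5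
    exact h5.2⟩

lemma locFun_pairFun (φ : Chart n X) (g : SmoothT02 n X) (ξ η : SmoothVF n X) {y : Euc n}
    (hy : y ∈ φ.1.target) :
    locT02 φ g y (locVF φ ξ y) (locVF φ η y) = locFun φ (pairFun g ξ η) y := by
  have hx := φ.1.map_target hy
  have hm : φ.1.MDifferentiable (𝓡 n) (𝓡 n) :=
    ⟨(contMDiffOn_of_mem_maximalAtlas φ.2).mdifferentiableOn (by simp),
      (contMDiffOn_symm_of_mem_maximalAtlas φ.2).mdifferentiableOn (by simp)⟩
  have key := hm.symm_comp_deriv hx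
  rw [φ.1.right_inv hy] at key
  have k1 : ∀ v : TangentSpace (𝓡 n) (φ.1.symm y),
      mfderiv (𝓡 n) (𝓡 n) φ.1.symm y (mfderiv (𝓡 n) (𝓡 n) φ.1 (φ.1.symm y) v) = v :=
    fun v => DFunLike.congr_fun key v
  rw [locT02_apply]
  unfold locVF
  rw [k1, k1]
  rfl

end Manifold

/-! ### Generalized numbers -/

lemma OEps.mono {a : Eps → ℝ} {p q : ℤ} (h : OEps a q) (hpq : p ≤ q) : OEps a p := by
  obtain ⟨C, hC⟩ := h
  refine ⟨|C|, hC.mono fun ε hε => hε.trans ?_⟩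
  have h1 := zpow_anti ε hpq
  have h2 : 0 < (ε : ℝ) ^ q := zpow_pos ε.2.1 q
  calc C * (ε : ℝ) ^ q ≤ |C| * (ε : ℝ) ^ q := by gcongr; exact le_abs_self C
    _ ≤ |C| * (ε : ℝ) ^ p := by gcongr

lemma OEps.add {a b : Eps → ℝ} {p : ℤ} (ha : OEps a p) (hb : OEps b p) : OEps (a + b) p := by
  obtain ⟨C, hC⟩ := ha
  obtain ⟨D, hD⟩ := hb
  refine ⟨C + D, ?_⟩
  filter_upwards [hC, hD] with ε h1 h2
  rw [add_mul]
  exact (abs_add_le _ _).trans (add_le_add h1 h2)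

lemma OEps.mul {a b : Eps → ℝ} {p q : ℤ} (ha : OEps a p) (hb : OEps b q) :
    OEps (a * b) (p + q) := by
  obtain ⟨C, hC⟩ := ha
  obtain ⟨D, hD⟩ := hb
  refine ⟨C * D, ?_⟩
  filter_upwards [hC, hD] with ε h1 h2
  rw [Pi.mul_apply, abs_mul, zpow_add₀ ε.2.1.ne']
  calc |a ε| * |b ε| ≤ (C * (ε : ℝ) ^ p) * (D * (ε : ℝ) ^ q) :=
        mul_le_mul h1 h2 (abs_nonneg _) ((abs_nonneg _).trans h1)
    _ = _ := by ring

lemma OEps.neg {a : Eps → ℝ} {p : ℤ} (ha : OEps a p) : OEps (-a) p := by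
  obtain ⟨C, hC⟩ := ha
  exact ⟨C, hC.mono fun ε h => by simpa using h⟩

lemma OEps.const (c : ℝ) : OEps (fun _ => c) 0 := ⟨|c|, Eventually.of_forall fun ε => by simp⟩

lemma OEps.zero (p : ℤ) : OEps 0 p := ⟨0, Eventually.of_forall fun ε => by simp⟩

/-- The ring `𝓔_M` of moderate nets of real numbers. -/
def moderateNum : Subring (Eps → ℝ) where
  carrier := {a | ModerateNum a}
  mul_mem' := fun ⟨p, hp⟩ ⟨q, hq⟩ => ⟨p + q, hp.mul hq⟩
  one_mem' := ⟨0, OEps.const 1⟩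
  add_mem' := fun ⟨p, hp⟩ ⟨q, hq⟩ =>
    ⟨min p q, (hp.mono (min_le_left _ _)).add (hq.mono (min_le_right _ _))⟩
  zero_mem' := ⟨0, OEps.const 0⟩
  neg_mem' := fun ⟨p, hp⟩ => ⟨p, hp.neg⟩

/-- The ideal `𝓝` of negligible nets of real numbers. -/
def negligibleNum : Ideal moderateNum where
  carrier := {a | NegligibleNum a.1}
  add_mem' := fun ha hb p => (ha p).add (hb p)
  zero_mem' := fun p => OEps.zero p
  smul_mem' := fun c a ha p => by
    obtain ⟨q, hq⟩ := c.2
    have := hq.mul (ha (p - q))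
    simpa using this

/-- The ring of generalized real numbers. -/
abbrev GenReal : Type := moderateNum ⧸ negligibleNum

/-- The class of a moderate net of real numbers. -/
def GenReal.ofNet (a : Eps → ℝ) (h : ModerateNum a) : GenReal :=
  Ideal.Quotient.mk negligibleNum ⟨a, h⟩

lemma GenReal.ofNet_eq {a b : Eps → ℝ} (ha : ModerateNum a) (hb : ModerateNum b)
    (h : NegligibleNum (a - b)) : GenReal.ofNet a ha = GenReal.ofNet b hb :=
  Ideal.Quotient.eq.2 h

/-- `∃ m ≥ 0, ∃ ε₀, ∀ ε < ε₀, a_ε ≥ ε^m`. -/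
def StrictlyPosNet (a : Eps → ℝ) : Prop := ∃ m : ℕ, ∀ᶠ ε : Eps in epsZero, (ε : ℝ) ^ m ≤ a ε

/-- Strict positivity `a > 0` of a generalized number. -/
def GenReal.IsPos (a : GenReal) : Prop :=
  ∃ (r : Eps → ℝ) (h : ModerateNum r), GenReal.ofNet r h = a ∧ StrictlyPosNet r

/-- Strict negativity `a < 0` of a generalized number. -/
def GenReal.IsNeg (a : GenReal) : Prop := (-a).IsPos

/-! ### Bilinear forms on `ℝ̃ⁿ` and causality -/

/-- The matrix `A` over the generalized numbers is symmetric with `ν₊(A) + ν₋(A) = n` and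
`ν₋(A) = j`: for a symmetric representative `(R_ε)` of `A`, the nets of the `k`-th largest
eigenvalues of `R_ε`, `k = 1, …, n`, represent the generalized eigenvalues of `A`; all of them are
strictly positive or strictly negative, and exactly `j` are strictly negative. -/
def MatrixHasIndex {n : ℕ} (A : Matrix (Fin n) (Fin n) GenReal) (j : ℕ) : Prop :=
  ∃ (R : Eps → Matrix (Fin n) (Fin n) ℝ) (hs : ∀ ε, (R ε).IsHermitian)
    (hm : ∀ i k, ModerateNum fun ε => R ε i k),
    (∀ i k, GenReal.ofNet (fun ε => R ε i k) (hm i k) = A i k) ∧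
    {k | StrictlyPosNet fun ε => (hs ε).eigenvalues₀ k}.ncard +
      {k | StrictlyPosNet fun ε => -(hs ε).eigenvalues₀ k}.ncard = n ∧
    {k | StrictlyPosNet fun ε => -(hs ε).eigenvalues₀ k}.ncard = j

/-- The symmetric bilinear form `b` on `ℝ̃ⁿ` has index `j`: its coefficient matrix with respect to
some basis has index `j`. -/
def HasIndex {n : ℕ} (b : LinearMap.BilinForm GenReal (Fin n → GenReal)) (j : ℕ) : Prop :=
  b.IsSymm ∧ ∃ e : Module.Basis (Fin n) GenReal (Fin n → GenReal),
    MatrixHasIndex (Matrix.of fun i k => b (e i) (e k)) j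

/-- Symmetric bilinear forms of Lorentzian signature on `ℝ̃ⁿ`. -/
def IsLorentzianForm {n : ℕ} (b : LinearMap.BilinForm GenReal (Fin n → GenReal)) : Prop :=
  HasIndex b 1

/-- A free element of `ℝ̃ⁿ`: `a • u = 0` only for `a = 0`. -/
def IsFree {n : ℕ} (u : Fin n → GenReal) : Prop := LinearIndependent GenReal ![u]

/-- Time-like elements of `ℝ̃ⁿ`: `b(u,u) < 0`. -/
def IsTimelike {n : ℕ} (b : LinearMap.BilinForm GenReal (Fin n → GenReal))
    (u : Fin n → GenReal) : Prop := (b u u).IsNeg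

/-- Space-like elements of `ℝ̃ⁿ`: `b(u,u) > 0`. -/
def IsSpacelike {n : ℕ} (b : LinearMap.BilinForm GenReal (Fin n → GenReal))
    (u : Fin n → GenReal) : Prop := (b u u).IsPos

/-- Null elements of `ℝ̃ⁿ`: `u = 0`, or `u` is free and `b(u,u) = 0`. -/
def IsNull {n : ℕ} (b : LinearMap.BilinForm GenReal (Fin n → GenReal))
    (u : Fin n → GenReal) : Prop := u = 0 ∨ (IsFree u ∧ b u u = 0)

/-! ### Generalized points of open subsets of `ℝⁿ` -/

/-- Compactly supported nets of points of `Ω`. -/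
structure CNet {E : Type*} [NormedAddCommGroup E] (Ω : Set E) where
  /-- the net -/
  pt : Eps → E
  mem : ∀ ε, pt ε ∈ Ω
  compactly_supported : ∃ K ⊆ Ω, IsCompact K ∧ ∀ᶠ ε in epsZero, pt ε ∈ K

/-- Equivalence of nets of points: `|x_ε - y_ε| = O(ε^m)` for all `m`. -/
def CNet.setoid {E : Type*} [NormedAddCommGroup E] (Ω : Set E) : Setoid (CNet Ω) where
  r x y := NegligibleNum fun ε => ‖x.pt ε - y.pt ε‖
  iseqv :=
    { refl := fun x p => by simpa [Pi.zero_def] using OEps.zero p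
      symm := fun {x y} h p => by simpa only [norm_sub_rev] using h p
      trans := fun {x y z} h1 h2 p => by
        obtain ⟨C, hC⟩ := (h1 p).add (h2 p)
        refine ⟨C, hC.mono fun ε h => le_trans ?_ h⟩
        simp only [Pi.add_apply, abs_norm]
        rw [abs_of_nonneg (by positivity)]
        exact norm_sub_le_norm_sub_add_norm_sub _ _ _ }

/-- The set `Ω̃_c` of compactly supported generalized points of `Ω`. -/
def GenPoint {E : Type*} [NormedAddCommGroup E] (Ω : Set E) : Type _ := Quotient (CNet.setoid Ω)

section Evaluation

variable {E F : Type*} [NormedAddCommGroup E] [NormedSpace ℝ E]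
  [NormedAddCommGroup F] [NormedSpace ℝ F]

lemma eval_O {Ω : Set E} {K : Set E} {u : Eps → E → F} (L : F →L[ℝ] ℝ) {p : ℤ}
    (hu : OOn K 0 p u) (x : CNet Ω) (hx : ∀ᶠ ε in epsZero, x.pt ε ∈ K) :
    OEps (fun ε => L (u ε (x.pt ε))) p := by
  obtain ⟨C, hC⟩ := hu
  refine ⟨‖L‖ * C, ?_⟩
  filter_upwards [hC, hx] with ε h1 h2
  have := h1 _ h2
  rw [norm_iteratedFDeriv_zero] at this
  rw [← Real.norm_eq_abs, mul_assoc]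
  exact (L.le_opNorm _).trans (mul_le_mul_of_nonneg_left this (norm_nonneg _))

lemma eval_moderate {Ω : Set E} {u : Eps → E → F} (L : F →L[ℝ] ℝ) (hu : ModerateOn Ω u)
    (x : CNet Ω) : ModerateNum (fun ε => L (u ε (x.pt ε))) := by
  obtain ⟨K, hK, hc, hx⟩ := x.compactly_supported
  obtain ⟨p, hp⟩ := hu K hK hc 0
  exact ⟨p, eval_O L hp x hx⟩

lemma eval_negligible {Ω : Set E} {u : Eps → E → F} (L : F →L[ℝ] ℝ) (hu : NegligibleOn Ω u)
    (x : CNet Ω) : NegligibleNum (fun ε => L (u ε (x.pt ε))) := by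
  obtain ⟨K, hK, hc, hx⟩ := x.compactly_supported
  exact fun p => eval_O L (hu K hK hc 0 p) x hx

lemma eps_tendsto : Tendsto (fun ε : Eps => (ε : ℝ)) epsZero (𝓝 0) := tendsto_comap

lemma eval_congr [ProperSpace E] {Ω : Set E} (hΩ : IsOpen Ω) {u : Eps → E → F} (L : F →L[ℝ] ℝ)
    (hu : ModerateOn Ω u) (su : ∀ ε, ContDiffOn ℝ ∞ (u ε) Ω) (x y : CNet Ω)
    (h : CNet.setoid Ω x y) :
    NegligibleNum (fun ε => L (u ε (x.pt ε)) - L (u ε (y.pt ε))) := by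
  obtain ⟨K, hK, hc, hx⟩ := x.compactly_supported
  obtain ⟨δ, hδ, hδΩ⟩ := hc.exists_cthickening_subset_open hΩ hK
  obtain ⟨p, C, hC⟩ := hu _ hδΩ hc.cthickening 1
  have hsmall : ∀ᶠ ε in epsZero, ‖x.pt ε - y.pt ε‖ ≤ δ := by
    obtain ⟨D, hD⟩ := h 1
    have h0 : Tendsto (fun ε : Eps => D * (ε : ℝ)) epsZero (𝓝 0) := by
      simpa using eps_tendsto.const_mul D
    filter_upwards [hD, h0.eventually (gt_mem_nhds hδ)] with ε h1 h2
    simp only [zpow_one, abs_norm] at h1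
    exact h1.trans h2.le
  intro m
  obtain ⟨D, hD⟩ := h (m - p)
  refine ⟨‖L‖ * (C * D), ?_⟩
  filter_upwards [hx, hC, hsmall, hD] with ε h1 h2 h3 h4
  have hball : Metric.closedBall (x.pt ε) δ ⊆ Metric.cthickening δ K :=
    Metric.closedBall_subset_cthickening h1 δ
  have hmv := (convex_closedBall (x.pt ε) δ).norm_image_sub_le_of_norm_fderiv_le (𝕜 := ℝ)
    (f := u ε) (C := C * (ε : ℝ) ^ p)
    (fun z hz => ((su ε).contDiffAt (hΩ.mem_nhds (hδΩ (hball hz)))).differentiableAt (by simp))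
    (fun z hz => by
      have := h2 z (hball hz)
      rwa [norm_iteratedFDeriv_one] at this)
    (x := y.pt ε) (y := x.pt ε) (by simpa [dist_eq_norm, norm_sub_rev] using h3)
    (Metric.mem_closedBall_self hδ.le)
  have hp : 0 < (ε : ℝ) ^ p := zpow_pos ε.2.1 p
  have hC0 : 0 ≤ C * (ε : ℝ) ^ p := (norm_nonneg _).trans (h2 _ (hball (Metric.mem_closedBall_self hδ.le)))
  rw [abs_norm] at h4
  rw [← map_sub, ← Real.norm_eq_abs]
  calc ‖L (u ε (x.pt ε) - u ε (y.pt ε))‖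
      ≤ ‖L‖ * ((C * (ε : ℝ) ^ p) * (D * (ε : ℝ) ^ (m - p))) :=
        (L.le_opNorm _).trans (mul_le_mul_of_nonneg_left
          (hmv.trans (mul_le_mul_of_nonneg_left h4 hC0)) (norm_nonneg _))
    _ = ‖L‖ * (C * D) * ((ε : ℝ) ^ p * (ε : ℝ) ^ (m - p)) := by ring
    _ = ‖L‖ * (C * D) * (ε : ℝ) ^ m := by rw [← zpow_add₀ ε.2.1.ne']; simp

end Evaluation

section GeneralizedTensors


set_option linter.unusedSectionVars false

variable {n : ℕ} {X : Type*} [TopologicalSpace X] [ChartedSpace (EuclideanSpace ℝ (Fin n)) X]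
  [IsManifold (𝓡 n) ∞ X]

/-! ### The algebra `𝓖(X)` -/

variable (n X) in
/-- The ring `𝓔_M(X)` of moderate nets of smooth functions: nets whose local expressions in all
charts are moderate. -/
def moderateFun : Subring (Eps → SmoothFun n X) where
  carrier := {f | ∀ φ : Chart n X, ModerateOn φ.1.target fun ε => locFun φ (f ε)}
  mul_mem' := fun {f h} hf hh φ => ModerateOn.bilin φ.1.open_target (ContinuousLinearMap.mul ℝ ℝ)
    (hf φ) (hh φ) (fun ε => locFun_smooth φ (f ε)) (fun ε => locFun_smooth φ (h ε))
  one_mem' := by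
    intro φ K hK hc k
    refine ⟨0, ‖(1 : ℝ)‖, Eventually.of_forall fun ε y hy => ?_⟩
    have h1 : locFun φ ((1 : Eps → SmoothFun n X) ε) = fun _ => (1 : ℝ) := rfl
    simp only [h1]
    rcases Nat.eq_zero_or_pos k with h | h
    · subst h; simp
    · rw [iteratedFDeriv_const_of_ne h.ne']; simp
  add_mem' := fun {f h} hf hh φ => (hf φ).add φ.1.open_target (hh φ)
    (fun ε => locFun_smooth φ (f ε)) (fun ε => locFun_smooth φ (h ε))
  zero_mem' := fun φ => (NegligibleOn.zero _).moderate
  neg_mem' := fun {f} hf φ => by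
    have := (hf φ).const_smul φ.1.open_target (-1) (fun ε => locFun_smooth φ (f ε))
    refine this.congr φ.1.open_target fun ε y _ => ?_
    simp [locFun]

variable (n X) in
/-- The ideal `𝓝(X)` of negligible nets of smooth functions. -/
def negligibleFun : Ideal (moderateFun n X) where
  carrier := {f | ∀ φ : Chart n X, NegligibleOn φ.1.target fun ε => locFun φ (f.1 ε)}
  add_mem' := fun {f h} hf hh φ => (hf φ).add φ.1.open_target (hh φ)
    (fun ε => locFun_smooth φ (f.1 ε)) (fun ε => locFun_smooth φ (h.1 ε))
  zero_mem' := fun _ => NegligibleOn.zero _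
  smul_mem' := fun c f hf φ => NegligibleOn.bilin_right φ.1.open_target
    (ContinuousLinearMap.mul ℝ ℝ) (c.2 φ) (hf φ)
    (fun ε => locFun_smooth φ (c.1 ε)) (fun ε => locFun_smooth φ (f.1 ε))

variable (n X) in
/-- The special Colombeau algebra `𝓖(X) = 𝓔_M(X) / 𝓝(X)`. -/
abbrev GenFun : Type _ := moderateFun n X ⧸ negligibleFun n X

/-- Strict positivity `f > 0` in `𝓖(X)`: `f` is invertible and for every compact `K ⊆ X` there is a
representative of `f` which is nonnegative on `K`. -/
def GenFun.IsPos (f : GenFun n X) : Prop :=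
  IsUnit f ∧ ∀ K : Set X, IsCompact K → ∃ r : moderateFun n X,
    Ideal.Quotient.mk (negligibleFun n X) r = f ∧ ∀ ε, ∀ x ∈ K, 0 ≤ r.1 ε x

/-- Strict negativity `f < 0` in `𝓖(X)`. -/
def GenFun.IsNeg (f : GenFun n X) : Prop := (-f).IsPos

/-! ### Generalized vector fields and generalized `(0,2)`-tensor fields -/

variable (n X) in
/-- Moderate nets of smooth vector fields. -/
def moderateVF : Submodule ℝ (Eps → SmoothVF n X) where
  carrier := {s | ∀ φ : Chart n X, ModerateOn φ.1.target fun ε => locVF φ (s ε)}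
  add_mem' := fun {s t} hs ht φ => by
    simpa only [Pi.add_apply, locVF_add] using (hs φ).add φ.1.open_target (ht φ)
      (fun ε => locVF_smooth φ (s ε)) (fun ε => locVF_smooth φ (t ε))
  zero_mem' := fun φ => by
    simpa only [Pi.zero_apply, locVF_zero] using (NegligibleOn.zero φ.1.target).moderate
  smul_mem' := fun c s hs φ => by
    simpa only [Pi.smul_apply, locVF_smul] using
      (hs φ).const_smul φ.1.open_target c (fun ε => locVF_smooth φ (s ε))

variable (n X) in
/-- Negligible nets of smooth vector fields. -/
def negligibleVF : Submodule ℝ (moderateVF n X) where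
  carrier := {s | ∀ φ : Chart n X, NegligibleOn φ.1.target fun ε => locVF φ (s.1 ε)}
  add_mem' := fun {s t} hs ht φ => by
    have := (hs φ).add φ.1.open_target (ht φ)
      (fun ε => locVF_smooth φ (s.1 ε)) (fun ε => locVF_smooth φ (t.1 ε))
    exact this.congr φ.1.open_target fun ε y _ => (congrFun (locVF_add φ (s.1 ε) (t.1 ε)) y).symm
  zero_mem' := fun φ => by
    simpa only [ZeroMemClass.coe_zero, Pi.zero_apply, locVF_zero] using
      NegligibleOn.zero φ.1.target
  smul_mem' := fun c s hs φ => by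
    have := (hs φ).const_smul φ.1.open_target c (fun ε => locVF_smooth φ (s.1 ε))
    exact this.congr φ.1.open_target fun ε y _ => (congrFun (locVF_smul φ c (s.1 ε)) y).symm

variable (n X) in
/-- Generalized vector fields `𝓖¹₀(X)`. -/
abbrev GenVF : Type _ := moderateVF n X ⧸ negligibleVF n X

variable (n X) in
/-- Moderate nets of smooth `(0,2)`-tensor fields. -/
def moderateT02 : Submodule ℝ (Eps → SmoothT02 n X) where
  carrier := {s | ∀ φ : Chart n X, ModerateOn φ.1.target fun ε => locT02 φ (s ε)}
  add_mem' := fun {s t} hs ht φ => by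
    have := (hs φ).add φ.1.open_target (ht φ)
      (fun ε => locT02_smooth φ (s ε)) (fun ε => locT02_smooth φ (t ε))
    exact this.congr φ.1.open_target fun ε y _ => (congrFun (locT02_add φ (s ε) (t ε)) y).symm
  zero_mem' := fun φ => (NegligibleOn.zero φ.1.target).moderate.congr φ.1.open_target
    fun ε y _ => (congrFun (locT02_zero φ) y).symm
  smul_mem' := fun c s hs φ => by
    have := (hs φ).const_smul φ.1.open_target c (fun ε => locT02_smooth φ (s ε))
    exact this.congr φ.1.open_target fun ε y _ => (congrFun (locT02_smul φ c (s ε)) y).symm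

variable (n X) in
/-- Negligible nets of smooth `(0,2)`-tensor fields. -/
def negligibleT02 : Submodule ℝ (moderateT02 n X) where
  carrier := {s | ∀ φ : Chart n X, NegligibleOn φ.1.target fun ε => locT02 φ (s.1 ε)}
  add_mem' := fun {s t} hs ht φ => by
    have := (hs φ).add φ.1.open_target (ht φ)
      (fun ε => locT02_smooth φ (s.1 ε)) (fun ε => locT02_smooth φ (t.1 ε))
    exact this.congr φ.1.open_target fun ε y _ => (congrFun (locT02_add φ (s.1 ε) (t.1 ε)) y).symm
  zero_mem' := fun φ => (NegligibleOn.zero φ.1.target).congr φ.1.open_target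
    fun ε y _ => (congrFun (locT02_zero φ) y).symm
  smul_mem' := fun c s hs φ => by
    have := (hs φ).const_smul φ.1.open_target c (fun ε => locT02_smooth φ (s.1 ε))
    exact this.congr φ.1.open_target fun ε y _ => (congrFun (locT02_smul φ c (s.1 ε)) y).symm

variable (n X) in
/-- Generalized `(0,2)`-tensor fields `𝓖⁰₂(X)`. -/
abbrev GenT02 : Type _ := moderateT02 n X ⧸ negligibleT02 n X

/-! ### The generalized function `g(ξ, η)` -/

lemma pair_moderate (g : moderateT02 n X) (ξ η : moderateVF n X) :
    (fun ε => pairFun (g.1 ε) (ξ.1 ε) (η.1 ε)) ∈ moderateFun n X := by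
  intro φ
  have h1 := ModerateOn.bilin φ.1.open_target (ContinuousLinearMap.id ℝ _) (g.2 φ) (ξ.2 φ)
    (fun ε => locT02_smooth φ (g.1 ε)) (fun ε => locVF_smooth φ (ξ.1 ε))
  have h2 := ModerateOn.bilin φ.1.open_target (ContinuousLinearMap.id ℝ _) h1 (η.2 φ)
    (fun ε => (locT02_smooth φ (g.1 ε)).clm_apply (locVF_smooth φ (ξ.1 ε)))
    (fun ε => locVF_smooth φ (η.1 ε))
  exact h2.congr φ.1.open_target fun ε y hy => locFun_pairFun φ _ _ _ hy

/-- The net `(g_ε(ξ_ε, η_ε))_ε`. -/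
def pairNet (g : moderateT02 n X) (ξ η : moderateVF n X) : moderateFun n X :=
  ⟨fun ε => pairFun (g.1 ε) (ξ.1 ε) (η.1 ε), pair_moderate g ξ η⟩

lemma pair_negl_left (g g' : moderateT02 n X) (ξ η : moderateVF n X)
    (h : g - g' ∈ negligibleT02 n X) : pairNet g ξ η - pairNet g' ξ η ∈ negligibleFun n X := by
  intro φ
  have h1 := NegligibleOn.bilin_left φ.1.open_target (ContinuousLinearMap.id ℝ _) (h φ) (ξ.2 φ)
    (fun ε => locT02_smooth φ _) (fun ε => locVF_smooth φ (ξ.1 ε))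
  have h2 := NegligibleOn.bilin_left φ.1.open_target (ContinuousLinearMap.id ℝ _) h1 (η.2 φ)
    (fun ε => (locT02_smooth φ _).clm_apply (locVF_smooth φ (ξ.1 ε)))
    (fun ε => locVF_smooth φ (η.1 ε))
  exact h2.congr φ.1.open_target fun ε y hy => locFun_pairFun φ _ _ _ hy

lemma pair_negl_mid (g : moderateT02 n X) (ξ ξ' η : moderateVF n X)
    (h : ξ - ξ' ∈ negligibleVF n X) : pairNet g ξ η - pairNet g ξ' η ∈ negligibleFun n X := by
  intro φ
  have h1 := NegligibleOn.bilin_right φ.1.open_target (ContinuousLinearMap.id ℝ _) (g.2 φ) (h φ)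
    (fun ε => locT02_smooth φ (g.1 ε)) (fun ε => locVF_smooth φ _)
  have h2 := NegligibleOn.bilin_left φ.1.open_target (ContinuousLinearMap.id ℝ _) h1 (η.2 φ)
    (fun ε => (locT02_smooth φ (g.1 ε)).clm_apply (locVF_smooth φ _))
    (fun ε => locVF_smooth φ (η.1 ε))
  refine h2.congr φ.1.open_target fun ε y hy => ?_
  refine (locFun_pairFun φ _ _ _ hy).trans ?_
  show g.1 ε _ (ξ.1 ε _ - ξ'.1 ε _) _ = g.1 ε _ (ξ.1 ε _) _ - g.1 ε _ (ξ'.1 ε _) _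
  rw [map_sub]; rfl

lemma pair_negl_right (g : moderateT02 n X) (ξ η η' : moderateVF n X)
    (h : η - η' ∈ negligibleVF n X) : pairNet g ξ η - pairNet g ξ η' ∈ negligibleFun n X := by
  intro φ
  have h1 := ModerateOn.bilin φ.1.open_target (ContinuousLinearMap.id ℝ _) (g.2 φ) (ξ.2 φ)
    (fun ε => locT02_smooth φ (g.1 ε)) (fun ε => locVF_smooth φ (ξ.1 ε))
  have h2 := NegligibleOn.bilin_right φ.1.open_target (ContinuousLinearMap.id ℝ _) h1 (h φ)
    (fun ε => (locT02_smooth φ (g.1 ε)).clm_apply (locVF_smooth φ (ξ.1 ε)))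
    (fun ε => locVF_smooth φ _)
  refine h2.congr φ.1.open_target fun ε y hy => ?_
  refine (locFun_pairFun φ _ _ _ hy).trans ?_
  show g.1 ε _ (ξ.1 ε _) (η.1 ε _ - η'.1 ε _) = g.1 ε _ (ξ.1 ε _) _ - g.1 ε _ (ξ.1 ε _) _
  rw [map_sub]

/-- The generalized function `g(ξ, η) ∈ 𝓖(X)`. -/
def GenT02.pair (g : GenT02 n X) (ξ η : GenVF n X) : GenFun n X :=
  Quotient.liftOn' (s₁ := Submodule.quotientRel _) g
    (fun g₀ => Quotient.liftOn₂' (s₁ := Submodule.quotientRel _) (s₂ := Submodule.quotientRel _)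
      ξ η (fun ξ₀ η₀ => Ideal.Quotient.mk (negligibleFun n X) (pairNet g₀ ξ₀ η₀))
      (fun ξ₁ η₁ ξ₂ η₂ h1 h2 => by
        rw [Submodule.quotientRel_def] at h1 h2
        exact (Ideal.Quotient.eq.2 (pair_negl_mid g₀ ξ₁ ξ₂ η₁ h1)).trans
          (Ideal.Quotient.eq.2 (pair_negl_right g₀ ξ₂ η₁ η₂ h2))))
    (fun g₁ g₂ h => by
      rw [Submodule.quotientRel_def] at h
      induction ξ using Submodule.Quotient.induction_on with | _ ξ
      induction η using Submodule.Quotient.induction_on with | _ η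
      exact Ideal.Quotient.eq.2 (pair_negl_left g₁ g₂ ξ η h))

/-! ### Point values in charts -/

/-- The net of the `i`-th components of a net of vector fields along a net of points. -/
def valueNetVF (φ : Chart n X) (s : Eps → SmoothVF n X) (y : CNet φ.1.target) (i : Fin n) :
    Eps → ℝ := fun ε => locVF φ (s ε) (y.pt ε) i

/-- The net of the `(i,j)`-th coefficients of a net of `(0,2)`-tensor fields along a net of
points. -/
def valueNetT02 (φ : Chart n X) (s : Eps → SmoothT02 n X) (y : CNet φ.1.target) (i j : Fin n) :
    Eps → ℝ := fun ε =>
  locT02 φ (s ε) (y.pt ε) (EuclideanSpace.single i 1) (EuclideanSpace.single j 1)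

/-- Coefficient functional on bilinear forms. -/
def coeffT02 (n : ℕ) (i j : Fin n) : (Euc n →L[ℝ] Euc n →L[ℝ] ℝ) →L[ℝ] ℝ :=
  (ContinuousLinearMap.apply ℝ ℝ (EuclideanSpace.single j (1 : ℝ))).comp
    (ContinuousLinearMap.apply ℝ _ (EuclideanSpace.single i (1 : ℝ)))

lemma valueNetVF_moderate (φ : Chart n X) (s : moderateVF n X) (y : CNet φ.1.target) (i : Fin n) :
    ModerateNum (valueNetVF φ s.1 y i) :=
  eval_moderate (F := Euc n) (EuclideanSpace.proj i : Euc n →L[ℝ] ℝ) (s.2 φ) y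

lemma valueNetVF_congr (φ : Chart n X) (s s' : moderateVF n X) (h : s - s' ∈ negligibleVF n X)
    (y y' : CNet φ.1.target) (h' : CNet.setoid _ y y') (i : Fin n) :
    GenReal.ofNet _ (valueNetVF_moderate φ s y i) =
      GenReal.ofNet _ (valueNetVF_moderate φ s' y' i) := by
  refine (GenReal.ofNet_eq _ (valueNetVF_moderate φ s y' i) ?_).trans (GenReal.ofNet_eq _ _ ?_)
  · exact eval_congr (F := Euc n) φ.1.open_target (EuclideanSpace.proj i : Euc n →L[ℝ] ℝ) (s.2 φ)
      (fun ε => locVF_smooth φ (s.1 ε)) y y' h'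
  · have h1 := (h φ).congr φ.1.open_target
      (v := fun ε => locVF φ (s.1 ε) - locVF φ (s'.1 ε)) fun ε y _ => map_sub _ _ _
    exact eval_negligible (F := Euc n) (EuclideanSpace.proj i : Euc n →L[ℝ] ℝ) h1 y'

lemma valueNetT02_moderate (φ : Chart n X) (s : moderateT02 n X) (y : CNet φ.1.target)
    (i j : Fin n) : ModerateNum (valueNetT02 φ s.1 y i j) :=
  eval_moderate (F := Euc n →L[ℝ] Euc n →L[ℝ] ℝ) (coeffT02 n i j) (s.2 φ) y

lemma valueNetT02_congr (φ : Chart n X) (s s' : moderateT02 n X) (h : s - s' ∈ negligibleT02 n X)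
    (y y' : CNet φ.1.target) (h' : CNet.setoid _ y y') (i j : Fin n) :
    GenReal.ofNet _ (valueNetT02_moderate φ s y i j) =
      GenReal.ofNet _ (valueNetT02_moderate φ s' y' i j) := by
  refine (GenReal.ofNet_eq _ (valueNetT02_moderate φ s y' i j) ?_).trans (GenReal.ofNet_eq _ _ ?_)
  · exact eval_congr (F := Euc n →L[ℝ] Euc n →L[ℝ] ℝ) φ.1.open_target (coeffT02 n i j) (s.2 φ)
      (fun ε => locT02_smooth φ (s.1 ε)) y y' h'
  · exact eval_negligible (F := Euc n →L[ℝ] Euc n →L[ℝ] ℝ) (coeffT02 n i j) (h φ) y'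

/-- The point value `ξ_α(x̃) ∈ ℝ̃ⁿ` of the local expression of a generalized vector field at a
compactly supported generalized point of `ψ_α(V_α)`. -/
def GenVF.value (ξ : GenVF n X) (φ : Chart n X) (x : GenPoint φ.1.target) : Fin n → GenReal :=
  fun i => Quotient.liftOn₂' (s₁ := Submodule.quotientRel (negligibleVF n X))
    (s₂ := CNet.setoid φ.1.target) ξ x
    (fun s y => GenReal.ofNet (valueNetVF φ s.1 y i) (valueNetVF_moderate φ s y i))
    (fun s y s' y' h h' =>
      valueNetVF_congr φ s s' ((Submodule.quotientRel_def _).1 h) y y' h' i)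

/-- The coefficient matrix of the point value `g_α(x̃)` of the local expression of a generalized
`(0,2)`-tensor field. -/
def GenT02.valueMatrix (g : GenT02 n X) (φ : Chart n X) (x : GenPoint φ.1.target) :
    Matrix (Fin n) (Fin n) GenReal :=
  Matrix.of fun i j => Quotient.liftOn₂' (s₁ := Submodule.quotientRel (negligibleT02 n X))
    (s₂ := CNet.setoid φ.1.target) g x
    (fun s y => GenReal.ofNet (valueNetT02 φ s.1 y i j) (valueNetT02_moderate φ s y i j))
    (fun s y s' y' h h' =>
      valueNetT02_congr φ s s' ((Submodule.quotientRel_def _).1 h) y y' h' i j)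

/-- The point value `g_α(x̃) : ℝ̃ⁿ × ℝ̃ⁿ → ℝ̃` of the local expression of a generalized
`(0,2)`-tensor field at a compactly supported generalized point of `ψ_α(V_α)`. -/
def GenT02.value (g : GenT02 n X) (φ : Chart n X) (x : GenPoint φ.1.target) :
    LinearMap.BilinForm GenReal (Fin n → GenReal) :=
  Matrix.toBilin' (g.valueMatrix φ x)

/-! ### Generalized pseudo-Riemannian metrics -/

/-- The bilinear form `g(x)` on the tangent space `T_x X`. -/
def SmoothT02.form (g : SmoothT02 n X) (x : X) : LinearMap.BilinForm ℝ (TangentSpace (𝓡 n) x) :=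
  (g x).toLinearMap₁₂

/-- `g` is a pseudo-Riemannian metric of index `j` on `V`: on each tangent space `T_x X`, `x ∈ V`,
it is symmetric and nondegenerate, and `j` is the maximal dimension of a negative definite
subspace. -/
def SmoothT02.IsPseudoRiemannianOn (g : SmoothT02 n X) (V : Set X) (j : ℕ) : Prop :=
  ∀ x ∈ V, (SmoothT02.form g x).IsSymm ∧ (SmoothT02.form g x).Nondegenerate ∧
    sigNeg (LinearMap.BilinMap.toQuadraticMap (SmoothT02.form g x)) = j

/-- `g` is a generalized pseudo-Riemannian metric of index `j`: all point values `g_α(x̃)` in charts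
are symmetric and nondegenerate, and for each relatively compact open `V ⊆ X` there are a
representative `(g_ε)` of `g` and an `ε₀ > 0` such that `g_ε` is a pseudo-Riemannian metric of
index `j` on `V` for all `ε < ε₀`. -/
def GenT02.IsMetricOfIndex (g : GenT02 n X) (j : ℕ) : Prop :=
  (∀ (φ : Chart n X) (x : GenPoint φ.1.target),
    (g.value φ x).IsSymm ∧ (g.value φ x).Nondegenerate) ∧
  ∀ V : Set X, IsOpen V → IsCompact (closure V) →
    ∃ r : moderateT02 n X, Submodule.Quotient.mk r = g ∧
      ∀ᶠ ε in epsZero, SmoothT02.IsPseudoRiemannianOn (r.1 ε) V j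

/-- Generalized Lorentzian metrics: generalized pseudo-Riemannian metrics of index `1`. -/
def GenT02.IsLorentzian (g : GenT02 n X) : Prop := g.IsMetricOfIndex 1

end GeneralizedTensors

end Colombeau

end

noncomputable section

namespace Colombeau

universe u

/-! ### Asymptotics of nets as `ε → 0` -/

section Asymptotics

/-! Everything about `ξ` reduces to the single generalized function `f = g(ξ, ξ)`: its point values
are those of `g` evaluated at those of `ξ` (`GenT02.value_apply_value`). The causal statements then
say that vanishing and strict positivity in `𝓖(X)` are detected by point values
(`GenFun.mk_eq_zero_iff`, `GenFun.isPos_mk_iff`).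

The bridge from points to uniform estimates is a choice argument. If an estimate fails on a compact
set for arbitrarily small `ε`, choosing bad points gives a compactly supported net along which it
fails. For vanishing, this bounds the values of `f` by every power of `ε`; the derivatives follow by
interpolating between the values and the moderate second derivatives
(`ModerateOn.negligible_of_zero`). For positivity, the exponent could depend on the net, and a
diagonal choice produces one exponent per compact set (`exists_pow_le_of_forall_net`). A global
inverse is then obtained by inverting `f² + exp(-1/ε)`, which is positive everywhere and has the
same class as `f²`.

For the signature, nondegeneracy of a point value keeps the eigenvalues of a representing matrix
above a power of `ε` in absolute value (`exists_pow_le_abs_eigenvalues`): otherwise unit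
eigenvectors with too small eigenvalues would represent a nonzero kernel vector. A representative of
index 1 near the net gives, by Sylvester's law, exactly one negative eigenvalue for small `ε`
(`sigNeg_form_eq_ncard`). Together, the last ordered eigenvalue is strictly negative and the others
are strictly positive (`matrixHasIndex_one`). -/

instance epsZero_neBot : epsZero.NeBot := by
  rw [epsZero, comap_neBot_iff_frequently]
  have h : ∀ᶠ x : ℝ in 𝓝[>] 0, x ∈ Ioc (0 : ℝ) 1 := Ioc_mem_nhdsGT one_pos
  exact (h.frequently.filter_mono nhdsWithin_le_nhds).mono fun x hx => ⟨⟨x, hx⟩, rfl⟩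

lemma eventually_lt_epsZero {δ : ℝ} (hδ : 0 < δ) : ∀ᶠ ε : Eps in epsZero, (ε : ℝ) < δ :=
  eps_tendsto.eventually (gt_mem_nhds hδ)

/-- One spare power of `ε` absorbs any constant, so later estimates can trade an `O`-bound for a
constant-free one. -/
lemma eventually_mul_zpow_le (C : ℝ) {p q : ℤ} (h : p < q) :
    ∀ᶠ ε : Eps in epsZero, C * (ε : ℝ) ^ q ≤ (ε : ℝ) ^ p := by
  filter_upwards [eventually_lt_epsZero (δ := (|C| + 1)⁻¹) (by positivity)] with ε hε
  have h0 := ε.2.1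
  have h1 : (ε : ℝ) ^ q ≤ (ε : ℝ) ^ (p + 1) := zpow_anti ε h
  have h2 : |C| * ε ≤ 1 := by
    have : (|C| + 1) * ε < 1 := by rwa [← lt_inv_mul_iff₀ (by positivity), mul_one]
    nlinarith
  calc C * (ε : ℝ) ^ q ≤ |C| * (ε : ℝ) ^ (p + 1) :=
        mul_le_mul (le_abs_self C) h1 (zpow_pos h0 q).le (abs_nonneg C)
    _ = (|C| * ε) * (ε : ℝ) ^ p := by rw [zpow_add_one₀ h0.ne']; ring
    _ ≤ 1 * (ε : ℝ) ^ p := by gcongr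
    _ = _ := one_mul _

lemma OEps.eventually_le {a : Eps → ℝ} {p q : ℤ} (ha : OEps a q) (h : p < q) :
    ∀ᶠ ε : Eps in epsZero, |a ε| ≤ (ε : ℝ) ^ p := by
  obtain ⟨C, hC⟩ := ha
  filter_upwards [hC, eventually_mul_zpow_le C h] with ε h1 h2 using h1.trans h2

/-- If each `P m` can be satisfied for arbitrarily small `ε`, then a single net satisfies all of
them along a set of indices that accumulates at `0`. -/
lemma exists_net_of_frequently {α : Type*} {P : ℕ → Eps → α → Prop}
    (hP : ∀ m k ε a, m ≤ k → P k ε a → P m ε a)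
    (h : ∀ m, ∃ᶠ ε in epsZero, ∃ a, P m ε a) :
    ∃ (S : Set Eps) (y : Eps → α), (∃ᶠ ε in epsZero, ε ∈ S) ∧
      (∀ ε ∈ S, P 0 ε (y ε)) ∧ ∀ m, ∀ᶠ ε in epsZero, ε ∈ S → P m ε (y ε) := by
  have h' : ∀ m : ℕ, ∃ ε : Eps, (∃ a, P m ε a) ∧ (ε : ℝ) < 1 / ((m : ℝ) + 1) := fun m =>
    ((h m).and_eventually (eventually_lt_epsZero (by positivity))).exists
  choose e he hlt using h'
  choose a ha using he
  have ht : Tendsto e atTop epsZero := by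
    rw [epsZero, tendsto_comap_iff]
    exact squeeze_zero (fun m => (e m).2.1.le) (fun m => (hlt m).le)
      tendsto_one_div_add_atTop_nhds_zero_nat
  -- `e` need not be injective, so `invFun` fixes one index for each point of its range.
  have hinv : ∀ ε ∈ range e, e (Function.invFun e ε) = ε := fun ε hε => Function.invFun_eq hε
  refine ⟨range e, fun ε => a (Function.invFun e ε),
    ht.frequently (Frequently.of_forall fun m => mem_range_self m), fun ε hε => ?_, fun m => ?_⟩
  · have := ha (Function.invFun e ε)
    rw [hinv ε hε] at this
    exact hP 0 _ _ _ (Nat.zero_le _) this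
  · have h1 : ∀ᶠ ε : Eps in epsZero, ∀ k ∈ Finset.range m, (ε : ℝ) < e k :=
      (Filter.eventually_all_finset _).2 fun k _ => eventually_lt_epsZero (e k).2.1
    filter_upwards [h1] with ε h2 hε
    have := ha (Function.invFun e ε)
    rw [hinv ε hε] at this
    refine hP m _ _ _ ?_ this
    by_contra! hlt
    have := h2 _ (Finset.mem_range.2 hlt)
    rw [hinv ε hε] at this
    exact lt_irrefl _ this

end Asymptotics

/-! ### Independence of the representative for generalized numbers -/

section GenReal

lemma GenReal.ofNet_eq_zero_iff {a : Eps → ℝ} (ha : ModerateNum a) :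
    GenReal.ofNet a ha = 0 ↔ NegligibleNum a := Ideal.Quotient.eq_zero_iff_mem

/-- A perturbation of size `ε^(m+1)` leaves `ε^m - ε^(m+1)`, which is at least `ε^(m+1)` once `ε <
1/2`. -/
lemma StrictlyPosNet.of_sub_negligible {a b : Eps → ℝ} (ha : StrictlyPosNet a)
    (h : NegligibleNum (a - b)) : StrictlyPosNet b := by
  obtain ⟨m, hm⟩ := ha
  refine ⟨m + 1, ?_⟩
  filter_upwards [hm, (h (m + 2)).eventually_le (p := m + 1) (by lia),
    eventually_lt_epsZero (δ := 1 / 2) (by norm_num)] with ε h1 h2 h3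
  have h4 : (a - b) ε ≤ (ε : ℝ) ^ (m + 1) := (le_abs_self _).trans (by exact_mod_cast h2)
  simp only [Pi.sub_apply] at h4
  have h5 : (0 : ℝ) < (ε : ℝ) ^ m := pow_pos ε.2.1 m
  rw [pow_succ] at h4 ⊢
  nlinarith

lemma GenReal.isPos_ofNet_iff {a : Eps → ℝ} (ha : ModerateNum a) :
    (GenReal.ofNet a ha).IsPos ↔ StrictlyPosNet a := by
  refine ⟨?_, fun h => ⟨a, ha, rfl, h⟩⟩
  rintro ⟨r, hr, h, hp⟩
  exact hp.of_sub_negligible (Ideal.Quotient.eq.1 h)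

end GenReal

/-! ### Nets on open sets: derivatives, inverses, uniformity from nets of points -/

section NetsOnOpenSets

variable {E F : Type*} [NormedAddCommGroup E] [NormedSpace ℝ E]
  [NormedAddCommGroup F] [NormedSpace ℝ F]

/-- A Landau–Kolmogorov type inequality: the first derivative is controlled by the function and its
second derivative on a ball. -/
lemma norm_fderiv_le_of_closedBall {Ω : Set E} (hΩ : IsOpen Ω) {u : E → F}
    (hu : ContDiffOn ℝ ∞ u Ω) {y : E} {t A M : ℝ} (ht : 0 < t) (hM0 : 0 ≤ M)
    (hball : Metric.closedBall y t ⊆ Ω) (hA : ∀ z ∈ Metric.closedBall y t, ‖u z‖ ≤ A)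
    (hM : ∀ z ∈ Metric.closedBall y t, ‖fderiv ℝ (fderiv ℝ u) z‖ ≤ M) :
    ‖fderiv ℝ u y‖ ≤ 2 * A / t + M * t := by
  have hy : y ∈ Metric.closedBall y t := Metric.mem_closedBall_self ht.le
  have hA0 : 0 ≤ A := (norm_nonneg _).trans (hA y hy)
  have hd : ∀ z ∈ Metric.closedBall y t, DifferentiableAt ℝ u z := fun z hz =>
    (hu.contDiffAt (hΩ.mem_nhds (hball hz))).differentiableAt (by simp)
  have hd' : ∀ z ∈ Metric.closedBall y t, DifferentiableAt ℝ (fderiv ℝ u) z := fun z hz =>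
    ((hu.fderiv_of_isOpen hΩ (m := ∞) (by simp)).contDiffAt
      (hΩ.mem_nhds (hball hz))).differentiableAt (by simp)
  have hdiff : ∀ z ∈ Metric.closedBall y t, ‖fderiv ℝ u z - fderiv ℝ u y‖ ≤ M * t := fun z hz =>
    ((convex_closedBall y t).norm_image_sub_le_of_norm_fderiv_le (𝕜 := ℝ) hd' hM hy hz).trans
      (mul_le_mul_of_nonneg_left (by simpa [dist_eq_norm] using hz) hM0)
  -- For a unit vector `z`, the first-order Taylor remainder of `u` at `y + t • z` is at most `M * t
  -- * t`, since the derivative varies by at most `M * t` on the ball. The increment of `u` is at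
  -- most `2 * A`; dividing by `t` gives the bound.
  refine ContinuousLinearMap.opNorm_le_of_unit_norm (by positivity) fun z hz => ?_
  have hz' : y + t • z ∈ Metric.closedBall y t := by
    simp [norm_smul, hz, abs_of_pos ht]
  have key := (convex_closedBall y t).norm_image_sub_le_of_norm_fderiv_le' (𝕜 := ℝ)
    hd hdiff hy hz'
  rw [add_sub_cancel_left, map_smul, norm_smul, hz, Real.norm_of_nonneg ht.le, mul_one] at key
  have h2 : t * ‖fderiv ℝ u y z‖ ≤ 2 * A + M * t * t := by
    have e1 : t * ‖fderiv ℝ u y z‖ = ‖t • fderiv ℝ u y z‖ := by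
      rw [norm_smul, Real.norm_of_nonneg ht.le]
    rw [e1]
    have e2 := norm_sub_le (u (y + t • z) - u y) (u (y + t • z) - u y - t • fderiv ℝ u y z)
    rw [sub_sub_cancel] at e2
    have e3 := norm_sub_le (u (y + t • z)) (u y)
    have e4 := hA _ hz'
    have e5 := hA _ hy
    linarith
  have h3 : 2 * A / t + M * t = (2 * A + M * t * t) / t := by field_simp
  rw [h3, le_div_iff₀ ht]
  linarith

lemma OOn.succ_of_fderiv {K : Set E} {k : ℕ} {p : ℤ} {u : Eps → E → F}
    (h : OOn K k p fun ε => fderiv ℝ (u ε)) : OOn K (k + 1) p u := by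
  simpa only [OOn, norm_iteratedFDeriv_fderiv] using h

lemma OOn.fderiv {K : Set E} {k : ℕ} {p : ℤ} {u : Eps → E → F}
    (h : OOn K (k + 1) p u) : OOn K k p fun ε => fderiv ℝ (u ε) := by
  simpa only [OOn, norm_iteratedFDeriv_fderiv] using h

/-- Interpolation on balls of radius `ε^N`: the values are small enough to survive division by
`ε^N`, and the second derivative, which is only moderate, is multiplied by `ε^N`. -/
lemma OOn.one_of_zero [ProperSpace E] {Ω : Set E} (hΩ : IsOpen Ω) {u : Eps → E → F}
    (hu : ModerateOn Ω u) (su : ∀ ε, ContDiffOn ℝ ∞ (u ε) Ω)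
    (h0 : ∀ K ⊆ Ω, IsCompact K → ∀ p : ℤ, OOn K 0 p u) {K : Set E} (hK : K ⊆ Ω)
    (hc : IsCompact K) (p : ℤ) : OOn K 1 p u := by
  obtain ⟨δ, hδ, hδΩ⟩ := hc.exists_cthickening_subset_open hΩ hK
  obtain ⟨q, C, hC⟩ := hu _ hδΩ hc.cthickening 2
  -- `N ≥ p - q` gives `ε^q * ε^N ≤ ε^p`; `N ≥ 1` gives `ε^N ≤ ε`, so the balls fit in the
  -- `δ`-thickening for small `ε`.
  set N : ℤ := max (p - q) 1
  have hN1 : p - q ≤ N := le_max_left _ _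
  have hN2 : 1 ≤ N := le_max_right _ _
  obtain ⟨D, hD⟩ := h0 _ hδΩ hc.cthickening (p + N)
  refine ⟨2 * D + |C|, ?_⟩
  filter_upwards [hC, hD, eventually_lt_epsZero hδ] with ε h1 h2 h3 y hy
  have hε := ε.2.1
  have ht : (ε : ℝ) ^ N ≤ δ := by
    have := zpow_anti ε hN2
    rw [zpow_one] at this
    linarith
  have hball : Metric.closedBall y ((ε : ℝ) ^ N) ⊆ Metric.cthickening δ K :=
    (Metric.closedBall_subset_closedBall ht).trans (Metric.closedBall_subset_cthickening hy δ)
  rw [norm_iteratedFDeriv_one]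
  refine (norm_fderiv_le_of_closedBall hΩ (su ε) (zpow_pos hε N) (by positivity) (hball.trans hδΩ)
    (A := D * (ε : ℝ) ^ (p + N)) (M := |C| * (ε : ℝ) ^ q)
    (fun z hz => ?_) (fun z hz => ?_)).trans ?_
  · simpa only [norm_iteratedFDeriv_zero] using h2 z (hball hz)
  · have := h1 z (hball hz)
    rw [← norm_iteratedFDeriv_fderiv, norm_iteratedFDeriv_one] at this
    exact this.trans (by gcongr; exact le_abs_self C)
  have e1 : 2 * (D * (ε : ℝ) ^ (p + N)) / (ε : ℝ) ^ N = 2 * D * (ε : ℝ) ^ p := by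
    rw [zpow_add₀ hε.ne']; field_simp
  have e2 : |C| * (ε : ℝ) ^ q * (ε : ℝ) ^ N ≤ |C| * (ε : ℝ) ^ p := by
    rw [mul_assoc, ← zpow_add₀ hε.ne']
    exact mul_le_mul_of_nonneg_left (zpow_anti ε (by lia)) (abs_nonneg C)
  rw [e1, add_mul]
  exact add_le_add le_rfl e2

/-- A moderate net whose values are negligible on compact sets is negligible: the derivatives need
not be checked. -/
lemma ModerateOn.negligible_of_zero {E F : Type u} [NormedAddCommGroup E] [NormedSpace ℝ E]
    [NormedAddCommGroup F] [NormedSpace ℝ F] [ProperSpace E] {Ω : Set E} (hΩ : IsOpen Ω)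
    {u : Eps → E → F} (hu : ModerateOn Ω u) (su : ∀ ε, ContDiffOn ℝ ∞ (u ε) Ω)
    (h0 : ∀ K ⊆ Ω, IsCompact K → ∀ p : ℤ, OOn K 0 p u) : NegligibleOn Ω u := by
  intro K hK hc k
  -- The step replaces `u` by its derivative, with values in `E →L[ℝ] F`; hence `F` is generalized
  -- and shares its universe with `E`.
  induction k generalizing F with
  | zero => exact h0 K hK hc
  | succ k ih =>
    refine fun p => OOn.succ_of_fderiv (ih (u := fun ε => fderiv ℝ (u ε))
      (fun K hK hc k => (hu K hK hc (k + 1)).imp fun q hq => hq.fderiv)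
      (fun ε => (su ε).fderiv_of_isOpen hΩ (by simp))
      (fun K hK hc q => (OOn.one_of_zero hΩ hu su h0 hK hc q).fderiv) p)

lemma OOn.congr {Ω K : Set E} (hΩ : IsOpen Ω) (hK : K ⊆ Ω) {k : ℕ} {p : ℤ} {u v : Eps → E → F}
    (hu : OOn K k p u) (h : ∀ ε, EqOn (u ε) (v ε) Ω) : OOn K k p v := by
  obtain ⟨C, hC⟩ := hu
  refine ⟨C, hC.mono fun ε h1 y hy => ?_⟩
  rw [← ((h ε).eventuallyEq_of_mem (hΩ.mem_nhds (hK hy))).iteratedFDeriv ℝ k |>.eq_of_nhds]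
  exact h1 y hy

/-- The inverse of a moderate net of positive functions that is bounded below by a power of `ε` on
each compact set is moderate. -/
lemma ModerateOn.inv {Ω : Set E} (hΩ : IsOpen Ω) {u : Eps → E → ℝ} (hu : ModerateOn Ω u)
    (su : ∀ ε, ContDiffOn ℝ ∞ (u ε) Ω) (pos : ∀ ε, ∀ y ∈ Ω, 0 < u ε y)
    (hb : ∀ K ⊆ Ω, IsCompact K → ∃ m : ℕ, ∀ᶠ ε : Eps in epsZero, ∀ y ∈ K, (ε : ℝ) ^ m ≤ u ε y) :
    ModerateOn Ω fun ε y => (u ε y)⁻¹ := by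
  intro K hK hc
  have sv : ∀ ε, ContDiffOn ℝ ∞ (fun y => (u ε y)⁻¹) Ω := fun ε =>
    (su ε).inv fun y hy => (pos ε y hy).ne'
  have sd : ∀ ε, ContDiffOn ℝ ∞ (_root_.fderiv ℝ (u ε)) Ω := fun ε =>
    (su ε).fderiv_of_isOpen hΩ (by simp)
  have main : ∀ k : ℕ, ∃ p : ℤ, ∀ i ≤ k, OOn K i p fun ε y => (u ε y)⁻¹ := by
    intro k
    induction k with
    | zero =>
      obtain ⟨m, hm⟩ := hb K hK hc
      refine ⟨-m, fun i hi => ?_⟩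
      rw [Nat.le_zero.1 hi]
      refine ⟨1, hm.mono fun ε h y hy => ?_⟩
      rw [norm_iteratedFDeriv_zero, one_mul, zpow_neg, zpow_natCast, norm_inv,
        Real.norm_of_nonneg (pos ε y (hK hy)).le]
      exact inv_anti₀ (pow_pos ε.2.1 m) (h y hy)
    | succ k ih =>
      obtain ⟨p, hp⟩ := ih
      obtain ⟨q, hq⟩ := hu.unif hK hc (k + 1)
      have h1 : ∀ i ≤ k, OOn K i (p + p) fun ε y => (u ε y)⁻¹ * (u ε y)⁻¹ := fun i hi =>
        OOn.bilin (ContinuousLinearMap.mul ℝ ℝ) hΩ hK (fun j hj => hp j (hj.trans hi))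
          (fun j hj => hp j (hj.trans hi)) sv sv
      have h2 : ∀ i ≤ k, OOn K i q fun ε => _root_.fderiv ℝ (u ε) := fun i hi =>
        (hq (i + 1) (by lia)).fderiv
      -- From `D(u⁻¹) = -u⁻² • Du`, order `k + 1` of the inverse is controlled by its orders up to
      -- `k` and by those of `Du` up to `k`.
      have h3 := OOn.bilin (k := k) (-(ContinuousLinearMap.lsmul ℝ ℝ : ℝ →L[ℝ] (E →L[ℝ] ℝ) →L[ℝ] _))
        hΩ hK h1 h2 (fun ε => (sv ε).mul (sv ε)) sd
      have h4 : OOn K (k + 1) (p + p + q) fun ε y => (u ε y)⁻¹ := by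
        refine OOn.succ_of_fderiv (h3.congr hΩ hK fun ε y hy => ?_)
        have hd : HasFDerivAt (u ε) (_root_.fderiv ℝ (u ε) y) y :=
          (((su ε).contDiffAt (hΩ.mem_nhds hy)).differentiableAt (by simp)).hasFDerivAt
        have := (hasDerivAt_inv (pos ε y hy).ne').comp_hasFDerivAt y hd
        rw [show (fun y => (u ε y)⁻¹) = Inv.inv ∘ u ε from rfl, this.fderiv]
        ext v
        simp [sq]
      refine ⟨min p (p + p + q), fun i hi => ?_⟩
      rcases Nat.le_succ_iff.1 hi with h | h
      · exact (hp i h).mono (min_le_left _ _)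
      · subst h; exact h4.mono (min_le_right _ _)
  exact fun k => (main k).imp fun p hp => hp k le_rfl

/-- A property that holds for small `ε` along every compactly supported net of points holds for
small `ε` at all points of a compact set. -/
lemma eventually_forall_mem_of_forall_net {E : Type*} [NormedAddCommGroup E] {Ω K : Set E} (hK : K ⊆ Ω) (hc : IsCompact K)
    {P : Eps → E → Prop} (h : ∀ x : CNet Ω, ∀ᶠ ε in epsZero, P ε (x.pt ε)) :
    ∀ᶠ ε in epsZero, ∀ y ∈ K, P ε y := by
  classical
  rcases K.eq_empty_or_nonempty with rfl | ⟨y₀, hy₀⟩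
  · simp
  -- A net in `K` that selects a counterexample whenever one exists; the hypothesis along it
  -- excludes counterexamples for small `ε`.
  let f : Eps → E := fun ε => if h : ∃ y ∈ K, ¬ P ε y then h.choose else y₀
  have hf : ∀ ε, f ε ∈ K := by
    intro ε
    by_cases h : ∃ y ∈ K, ¬ P ε y
    · simp only [f, dif_pos h]; exact h.choose_spec.1
    · simpa only [f, dif_neg h] using hy₀
  filter_upwards [h ⟨f, fun ε => hK (hf ε), K, hK, hc, Eventually.of_forall hf⟩] with ε hε
  by_contra! hn
  simp only [f, dif_pos hn] at hε
  exact hn.choose_spec.2 hε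

/-- The constants in the `O`-bounds depend on the net. Using order `p + 1` removes them, leaving
`|u| ≤ ε^p`, a property that passes from nets to compact sets. -/
lemma OOn.zero_of_forall_net {Ω K : Set E} (hK : K ⊆ Ω) (hc : IsCompact K) {u : Eps → E → ℝ}
    (h : ∀ x : CNet Ω, NegligibleNum fun ε => u ε (x.pt ε)) (p : ℤ) : OOn K 0 p u := by
  refine ⟨1, ?_⟩
  filter_upwards [eventually_forall_mem_of_forall_net hK hc
    (P := fun ε y => |u ε y| ≤ (ε : ℝ) ^ p)
    fun x => (h x (p + 1)).eventually_le (lt_add_one p)] with ε h1 y hy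
  rw [norm_iteratedFDeriv_zero, one_mul]
  exact h1 y hy

/-- The exponent depends on the net, so no fixed pointwise property can be transferred directly. If
no exponent served all of `K`, a diagonal net would fall below every power of `ε` along indices
accumulating at `0`. -/
lemma exists_pow_le_of_forall_net {E : Type*} [NormedAddCommGroup E] {Ω K : Set E} (hK : K ⊆ Ω) (hc : IsCompact K) {u : Eps → E → ℝ}
    (h : ∀ x : CNet Ω, StrictlyPosNet fun ε => u ε (x.pt ε)) :
    ∃ m : ℕ, ∀ᶠ ε : Eps in epsZero, ∀ y ∈ K, (ε : ℝ) ^ m ≤ u ε y := by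
  classical
  by_contra! hn
  obtain ⟨S, f, hS, hf0, hf⟩ := exists_net_of_frequently
    (P := fun m ε y => y ∈ K ∧ u ε y < (ε : ℝ) ^ m)
    (fun m k ε a hmk ha => ⟨ha.1, ha.2.trans_le (pow_le_pow_of_le_one ε.2.1.le ε.2.2 hmk)⟩)
    hn
  obtain ⟨ε₀, hε₀⟩ := hS.exists
  -- Off `S` any point of `K` will do; only the indices in `S` produce the contradiction.
  let g : Eps → E := fun ε => if ε ∈ S then f ε else f ε₀
  have hg : ∀ ε, g ε ∈ K := by
    intro ε
    by_cases h : ε ∈ S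
    · simpa only [g, if_pos h] using (hf0 ε h).1
    · simpa only [g, if_neg h] using (hf0 ε₀ hε₀).1
  obtain ⟨m, hm⟩ := h ⟨g, fun ε => hK (hg ε), K, hK, hc, Eventually.of_forall hg⟩
  obtain ⟨ε, h1, h2, h3⟩ := (hS.and_eventually ((hf m).and hm)).exists
  simp only [g, if_pos h1] at h3
  exact absurd (h2 h1).2 (not_lt.2 h3)

end NetsOnOpenSets


/-! ### Negative numbers and explicit negligible nets -/

lemma GenReal.isNeg_ofNet_iff {a : Eps → ℝ} (ha : ModerateNum a) :
    (GenReal.ofNet a ha).IsNeg ↔ StrictlyPosNet (-a) :=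
  GenReal.isPos_ofNet_iff (moderateNum.neg_mem ha)

/-- The exponential series gives `exp(1/ε) ≥ (1/ε)^p / p!`, whence the constant `p!`. This net
serves as a positive regularization that does not change the class. -/
lemma negligibleNum_exp : NegligibleNum fun ε => Real.exp (-(ε : ℝ)⁻¹) := by
  intro p
  refine OEps.mono (q := p.toNat) ⟨p.toNat.factorial, Eventually.of_forall fun ε => ?_⟩
    (Int.self_le_toNat p)
  have hε := ε.2.1
  have h := Real.pow_div_factorial_le_exp (ε : ℝ)⁻¹ (inv_pos.2 hε).le p.toNat
  rw [abs_of_pos (Real.exp_pos _), Real.exp_neg, zpow_natCast]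
  calc (Real.exp (ε : ℝ)⁻¹)⁻¹ ≤ ((ε : ℝ)⁻¹ ^ p.toNat / p.toNat.factorial)⁻¹ :=
        inv_anti₀ (by positivity) h
    _ = _ := by rw [inv_div, inv_pow, div_inv_eq_mul]

lemma NegligibleOn.const {E : Type*} [NormedAddCommGroup E] [NormedSpace ℝ E] (Ω : Set E)
    {c : Eps → ℝ} (hc : NegligibleNum c) : NegligibleOn Ω fun ε (_ : E) => c ε := by
  intro K _ _ k p
  obtain ⟨C, hC⟩ := hc p
  refine ⟨C, hC.mono fun ε h y _ => ?_⟩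
  rcases Nat.eq_zero_or_pos k with rfl | hk
  · rwa [norm_iteratedFDeriv_zero, Real.norm_eq_abs]
  · rw [iteratedFDeriv_const_of_ne hk.ne', Pi.zero_apply, norm_zero]
    exact (abs_nonneg _).trans h

lemma NegligibleOn.of_eventually_eq_zero {E F : Type*} [NormedAddCommGroup E] [NormedSpace ℝ E]
    [NormedAddCommGroup F] [NormedSpace ℝ F] (Ω : Set E) {u : Eps → E → F}
    (h : ∀ᶠ ε in epsZero, u ε = fun _ => 0) : NegligibleOn Ω u := by
  intro K _ _ k p
  refine ⟨0, h.mono fun ε h y _ => ?_⟩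
  rw [h]
  simp

/-! ### Generalized functions on the manifold and their point values -/

section Manifold

set_option linter.unusedSectionVars false

variable {n : ℕ} {X : Type*} [TopologicalSpace X] [ChartedSpace (EuclideanSpace ℝ (Fin n)) X]
  [IsManifold (𝓡 n) ∞ X]

/-- The values of a net of functions along a net of points in a chart. -/
def valueNetFun (φ : Chart n X) (f : Eps → SmoothFun n X) (y : CNet φ.1.target) : Eps → ℝ :=
  fun ε => locFun φ (f ε) (y.pt ε)

lemma valueNetFun_moderate (φ : Chart n X) (f : moderateFun n X) (y : CNet φ.1.target) :
    ModerateNum (valueNetFun φ f.1 y) :=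
  eval_moderate (ContinuousLinearMap.id ℝ ℝ) (f.2 φ) y

lemma valueNetFun_negligible (φ : Chart n X) {f : moderateFun n X} (hf : f ∈ negligibleFun n X)
    (y : CNet φ.1.target) : NegligibleNum (valueNetFun φ f.1 y) :=
  eval_negligible (ContinuousLinearMap.id ℝ ℝ) (hf φ) y

/-- A generalized function vanishes if and only if all its point values vanish. -/
lemma GenFun.mk_eq_zero_iff (f : moderateFun n X) :
    Ideal.Quotient.mk (negligibleFun n X) f = 0 ↔
      ∀ (φ : Chart n X) (y : CNet φ.1.target), NegligibleNum (valueNetFun φ f.1 y) := by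
  rw [Ideal.Quotient.eq_zero_iff_mem]
  refine ⟨fun h φ y => valueNetFun_negligible φ h y, fun h φ => ?_⟩
  exact (f.2 φ).negligible_of_zero φ.1.open_target (fun ε => locFun_smooth φ (f.1 ε))
    fun K hK hc p => OOn.zero_of_forall_net hK hc (h φ) p

/-- An approximate inverse is at most `ε^(-m)`, so `a * c ≥ 1/2` forces `a ≥ ε^m / 2 ≥ ε^(m+1)`.
Nonnegativity of `a` lets the upper bound on `c` enter the product. -/
lemma strictlyPosNet_of_mul_sub_one {a c : Eps → ℝ} (ha : ∀ᶠ ε in epsZero, 0 ≤ a ε)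
    (hc : ModerateNum c) (h : NegligibleNum (a * c - 1)) : StrictlyPosNet a := by
  obtain ⟨p, hp⟩ := hc
  -- One power beyond `-p`, to absorb the constant in the bound on `c`.
  set m : ℕ := (1 - p).toNat
  have hm : 1 - p ≤ m := Int.self_le_toNat _
  refine ⟨m + 1, ?_⟩
  filter_upwards [ha, (hp.mono (p := 1 - m) (by lia)).eventually_le (p := -m) (by lia),
    (h 2).eventually_le (p := 1) (by lia), eventually_lt_epsZero (δ := 1 / 2) (by norm_num)]
    with ε h1 h2 h3 h4
  rw [zpow_one] at h3
  simp only [Pi.sub_apply, Pi.mul_apply, Pi.one_apply] at h3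
  have hε := ε.2.1
  have hpow : (0 : ℝ) < (ε : ℝ) ^ m := pow_pos hε m
  have h5 : 1 / 2 ≤ a ε * c ε := by linarith [(abs_le.1 h3).1]
  have h6 : a ε * c ε ≤ a ε * ((ε : ℝ) ^ m)⁻¹ := by
    refine mul_le_mul_of_nonneg_left ((le_abs_self _).trans ?_) h1
    simpa [zpow_neg] using h2
  have h7 : 1 / 2 * (ε : ℝ) ^ m ≤ a ε := by
    have := h5.trans h6
    rwa [← div_eq_mul_inv, le_div_iff₀ hpow] at this
  rw [pow_succ]
  nlinarith

/-- Along the net, a representative nonnegative on the image in `X` of the supporting compact set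
has an approximate moderate inverse, read off from a representative of the inverse in `𝓖(X)`. -/
lemma GenFun.strictlyPosNet_of_isPos {f : moderateFun n X}
    (hf : GenFun.IsPos (Ideal.Quotient.mk (negligibleFun n X) f)) (φ : Chart n X)
    (y : CNet φ.1.target) : StrictlyPosNet (valueNetFun φ f.1 y) := by
  obtain ⟨hu, hr⟩ := hf
  obtain ⟨K, hK, hc, hy⟩ := y.compactly_supported
  obtain ⟨r, hrf, hr0⟩ := hr _ (hc.image_of_continuousOn (φ.1.continuousOn_symm.mono hK))
  obtain ⟨b, hb⟩ := hu.exists_right_inv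
  obtain ⟨s, rfl⟩ := Ideal.Quotient.mk_surjective b
  rw [← hrf, ← map_mul, ← map_one (Ideal.Quotient.mk (negligibleFun n X)),
    Ideal.Quotient.eq] at hb
  have hpos : StrictlyPosNet (valueNetFun φ r.1 y) :=
    strictlyPosNet_of_mul_sub_one (hy.mono fun ε h => hr0 ε _ (mem_image_of_mem _ h))
      (valueNetFun_moderate φ s y) (valueNetFun_negligible φ hb y)
  exact hpos.of_sub_negligible (valueNetFun_negligible φ (Ideal.Quotient.eq.1 hrf) y)

variable (n X) in
/-- The constant smooth function. -/
def constFun (c : ℝ) : SmoothFun n X := ⟨fun _ => c, contMDiff_const⟩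

/-- The pointwise inverse of a positive smooth function. -/
def invFun (f : SmoothFun n X) (hf : ∀ x, 0 < f x) : SmoothFun n X :=
  ⟨fun x => (f x)⁻¹, f.contMDiff.inv₀ fun x => (hf x).ne'⟩

/-- Each `f_ε` may still vanish somewhere on `X`, since how small `ε` must be depends on the compact
set. Inverting `f² + δ` with `δ = exp(-1/ε)` avoids this: if `e` is the inverse, then `f * (f * e) -
1 = -(e * δ)` is negligible. -/
lemma GenFun.isUnit_of_forall_net {f : moderateFun n X}
    (h : ∀ (φ : Chart n X) (y : CNet φ.1.target), StrictlyPosNet (valueNetFun φ f.1 y)) :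
    IsUnit (Ideal.Quotient.mk (negligibleFun n X) f) := by
  have hδ : ∀ φ : Chart n X, NegligibleOn φ.1.target
      fun ε => locFun φ (constFun n X (Real.exp (-(ε : ℝ)⁻¹))) := fun φ =>
    NegligibleOn.const _ negligibleNum_exp
  let δ : moderateFun n X := ⟨fun ε => constFun n X (Real.exp (-(ε : ℝ)⁻¹)),
    fun φ => (hδ φ).moderate⟩
  have hδ' : δ ∈ negligibleFun n X := hδ
  let d : moderateFun n X := f * f + δ
  have hd : ∀ ε x, d.1 ε x = f.1 ε x * f.1 ε x + Real.exp (-(ε : ℝ)⁻¹) := fun ε x => rfl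
  have hpos : ∀ ε x, 0 < d.1 ε x := fun ε x => by
    rw [hd]; exact add_pos_of_nonneg_of_pos (mul_self_nonneg _) (Real.exp_pos _)
  let e : moderateFun n X := ⟨fun ε => invFun (d.1 ε) (hpos ε), fun φ => by
    refine ModerateOn.inv φ.1.open_target (d.2 φ) (fun ε => locFun_smooth φ (d.1 ε))
      (fun ε y _ => hpos ε _) fun K hK hc => ?_
    -- A lower bound `ε^m` for `f` on `K` yields `ε^(m+m)` for `f² + δ`.
    obtain ⟨m, hm⟩ := exists_pow_le_of_forall_net hK hc (u := fun ε => locFun φ (f.1 ε)) (h φ)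
    refine ⟨m + m, hm.mono fun ε h1 y hy => ?_⟩
    have h2 := h1 y hy
    have h3 : (0 : ℝ) < (ε : ℝ) ^ m := pow_pos ε.2.1 m
    have h4 : locFun φ (d.1 ε) y = locFun φ (f.1 ε) y * locFun φ (f.1 ε) y +
      Real.exp (-(ε : ℝ)⁻¹) := rfl
    change _ ≤ locFun φ (d.1 ε) y
    rw [pow_add, h4]
    have := mul_le_mul h2 h2 h3.le (h3.le.trans h2)
    linarith [Real.exp_pos (-(ε : ℝ)⁻¹)]⟩
  have hde : d * e = 1 := by
    refine Subtype.ext (funext fun ε => ContMDiffMap.ext fun x => ?_)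
    exact mul_inv_cancel₀ (hpos ε x).ne'
  refine IsUnit.of_mul_eq_one (Ideal.Quotient.mk (negligibleFun n X) (f * e)) ?_
  rw [← map_mul, ← map_one (Ideal.Quotient.mk (negligibleFun n X)), Ideal.Quotient.eq]
  have : f * (f * e) - 1 = -(e * δ) := by rw [← hde]; simp only [d]; ring
  rw [this]
  exact neg_mem (Ideal.mul_mem_left _ e hδ')

/-- Each point has a neighbourhood that a chart maps into a compact subset of its target, where the
argument along nets applies; compactness leaves finitely many such neighbourhoods. -/
lemma eventually_forall_mem_compact {P : Eps → X → Prop} {K : Set X} (hK : IsCompact K)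
    (h : ∀ (φ : Chart n X) (y : CNet φ.1.target), ∀ᶠ ε in epsZero, P ε (φ.1.symm (y.pt ε))) :
    ∀ᶠ ε in epsZero, ∀ x ∈ K, P ε x := by
  refine hK.induction_on (p := fun s => ∀ᶠ ε in epsZero, ∀ x ∈ s, P ε x) (by simp)
    (fun s t hst ht => ht.mono fun ε h x hx => h x (hst hx))
    (fun s t hs ht => ?_) (fun x _ => ?_)
  · filter_upwards [hs, ht] with ε h1 h2 x hx
    exact hx.elim (h1 x) (h2 x)
  · let φ : Chart n X := ⟨chartAt (Euc n) x, IsManifold.chart_mem_maximalAtlas x⟩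
    have hx : x ∈ φ.1.source := mem_chart_source (Euc n) x
    obtain ⟨N, hNc, hxN, hN⟩ := exists_compact_subset φ.1.open_target (φ.1.map_source hx)
    refine ⟨φ.1.source ∩ φ.1 ⁻¹' N, mem_nhdsWithin_of_mem_nhds (inter_mem
      (φ.1.open_source.mem_nhds hx)
      ((φ.1.continuousAt hx).preimage_mem_nhds (mem_interior_iff_mem_nhds.1 hxN))), ?_⟩
    filter_upwards [eventually_forall_mem_of_forall_net hN hNc
      (P := fun ε y => P ε (φ.1.symm y)) (h φ)] with ε h1 z hz
    have := h1 _ hz.2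
    rwa [φ.1.left_inv hz.1] at this

/-- Strict positivity of a generalized function is detected by its point values. -/
lemma GenFun.isPos_mk_iff (f : moderateFun n X) :
    GenFun.IsPos (Ideal.Quotient.mk (negligibleFun n X) f) ↔
      ∀ (φ : Chart n X) (y : CNet φ.1.target), StrictlyPosNet (valueNetFun φ f.1 y) := by
  classical
  refine ⟨fun h φ y => GenFun.strictlyPosNet_of_isPos h φ y, fun h =>
    ⟨GenFun.isUnit_of_forall_net h, fun K hK => ?_⟩⟩
  have hev : ∀ᶠ ε in epsZero, ∀ x ∈ K, 0 ≤ f.1 ε x := by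
    refine eventually_forall_mem_compact (n := n) hK fun φ y => ?_
    obtain ⟨m, hm⟩ := h φ y
    exact hm.mono fun ε h1 => (pow_pos ε.2.1 m).le.trans h1
  -- The definition asks for nonnegativity on `K` at every `ε`, not only small ones. The correction
  -- vanishes for small `ε` and replaces `f` by `0` at the bad indices.
  let c : Eps → SmoothFun n X := fun ε => if ∀ x ∈ K, 0 ≤ f.1 ε x then 0 else -f.1 ε
  have hc : ∀ φ : Chart n X, NegligibleOn φ.1.target fun ε => locFun φ (c ε) := fun φ =>
    NegligibleOn.of_eventually_eq_zero _ (hev.mono fun ε h1 => by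
      simp only [c, if_pos h1]; rfl)
  let c' : moderateFun n X := ⟨c, fun φ => (hc φ).moderate⟩
  have hc' : c' ∈ negligibleFun n X := hc
  refine ⟨f + c', Ideal.Quotient.eq.2 (by simpa using hc'), fun ε x hx => ?_⟩
  have h1 : (f + c').1 ε x = f.1 ε x + c ε x := rfl
  rw [h1]
  by_cases h2 : ∀ x ∈ K, 0 ≤ f.1 ε x
  · simp only [c, if_pos h2]
    simpa using h2 x hx
  · simp only [c, if_neg h2]
    exact (add_neg_cancel (f.1 ε x)).ge

lemma GenFun.isNeg_mk_iff (f : moderateFun n X) :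
    GenFun.IsNeg (Ideal.Quotient.mk (negligibleFun n X) f) ↔
      ∀ (φ : Chart n X) (y : CNet φ.1.target), StrictlyPosNet (-valueNetFun φ f.1 y) :=
  GenFun.isPos_mk_iff (-f)

lemma locT02_eq_sum (φ : Chart n X) (g : SmoothT02 n X) (y v w : Euc n) :
    locT02 φ g y v w = ∑ i, ∑ j, v i *
      locT02 φ g y (EuclideanSpace.single i 1) (EuclideanSpace.single j 1) * w j := by
  have hs : ∀ u : Euc n, u = ∑ i, u i • EuclideanSpace.single i (1 : ℝ) := fun u => by
    simpa using ((EuclideanSpace.basisFun (Fin n) ℝ).sum_repr u).symm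
  conv_lhs => rw [hs v, hs w]
  simp only [map_sum, map_smul, FunLike.coe_sum, Finset.sum_apply,
    FunLike.coe_smul, Pi.smul_apply, smul_eq_mul]
  rw [Finset.sum_comm]
  refine Finset.sum_congr rfl fun i _ => ?_
  rw [Finset.mul_sum]
  exact Finset.sum_congr rfl fun j _ => by ring

/-- The point values of `g(ξ, ξ)` are those of `g` evaluated at those of `ξ`. -/
lemma GenT02.value_apply_value (g : moderateT02 n X) (ξ : moderateVF n X) (φ : Chart n X)
    (y : CNet φ.1.target) :
    GenT02.value (Submodule.Quotient.mk g : GenT02 n X) φ (Quotient.mk _ y)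
      (GenVF.value (Submodule.Quotient.mk ξ : GenVF n X) φ (Quotient.mk _ y))
      (GenVF.value (Submodule.Quotient.mk ξ : GenVF n X) φ (Quotient.mk _ y)) =
    GenReal.ofNet _ (valueNetFun_moderate φ (pairNet g ξ ξ) y) := by
  change Matrix.toBilin' (GenT02.valueMatrix _ _ _) _ _ = _
  rw [Matrix.toBilin'_apply]
  -- Computing in `moderateNum` before passing to the quotient reduces the claim to an identity at
  -- each `ε`.
  let v : Fin n → moderateNum := fun i => ⟨valueNetVF φ ξ.1 y i, valueNetVF_moderate φ ξ y i⟩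
  let M : Fin n → Fin n → moderateNum := fun i j =>
    ⟨valueNetT02 φ g.1 y i j, valueNetT02_moderate φ g y i j⟩
  change ∑ i, ∑ j, Ideal.Quotient.mk negligibleNum (v i) * Ideal.Quotient.mk negligibleNum (M i j)
    * Ideal.Quotient.mk negligibleNum (v j) = Ideal.Quotient.mk negligibleNum _
  simp only [← map_mul, ← map_sum]
  congr 1
  refine Subtype.ext (funext fun ε => ?_)
  refine Eq.trans ?_ (locFun_pairFun φ (g.1 ε) (ξ.1 ε) (ξ.1 ε) (y.mem ε))
  rw [locT02_eq_sum]
  simp [v, M, valueNetVF, valueNetT02]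

end Manifold


/-! ### Eigenvalues and index of symmetric matrices -/

open Matrix in
/-- A family of symmetric matrices that represents a matrix over the generalized numbers with
trivial kernel has eigenvalues bounded away from zero by a power of `ε`. -/
lemma exists_pow_le_abs_eigenvalues {n : ℕ} {R : Eps → Matrix (Fin n) (Fin n) ℝ}
    (hs : ∀ ε, (R ε).IsHermitian) (hm : ∀ i k, ModerateNum fun ε => R ε i k)
    (hker : ∀ v : Fin n → GenReal,
      (Matrix.of fun i k => GenReal.ofNet (fun ε => R ε i k) (hm i k)) *ᵥ v = 0 → v = 0) :
    ∃ m : ℕ, ∀ᶠ ε : Eps in epsZero, ∀ i, (ε : ℝ) ^ m ≤ |(hs ε).eigenvalues i| := by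
  classical
  by_contra! hn
  obtain ⟨S, i, hS, -, hi⟩ := exists_net_of_frequently
    (P := fun m ε i => |(hs ε).eigenvalues i| < (ε : ℝ) ^ m)
    (fun m k ε a hmk ha => ha.trans_le (pow_le_pow_of_le_one ε.2.1.le ε.2.2 hmk)) hn
  -- Unit eigenvectors with too small eigenvalues on `S`, zero elsewhere: `R *ᵥ v` is negligible, so
  -- `hker` makes `v` negligible, against its unit length on `S`.
  let v : Eps → Fin n → ℝ := fun ε => if ε ∈ S then (hs ε).eigenvectorBasis (i ε) else 0
  have hle : ∀ ε k, |(hs ε).eigenvectorBasis (i ε) k| ≤ 1 := fun ε k => by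
    have := PiLp.norm_apply_le ((hs ε).eigenvectorBasis (i ε)) k
    rwa [(hs ε).eigenvectorBasis.norm_eq_one] at this
  have hv1 : ∀ k ε, |v ε k| ≤ 1 := fun k ε => by
    by_cases h : ε ∈ S
    · simpa only [v, if_pos h] using hle ε k
    · simp [v, if_neg h]
  have hvm : ∀ k, ModerateNum fun ε => v ε k := fun k =>
    ⟨0, 1, Eventually.of_forall fun ε => by simpa using hv1 k ε⟩
  have hz : (fun k => GenReal.ofNet _ (hvm k)) = (0 : Fin n → GenReal) := by
    refine hker _ (funext fun j => ?_)
    let v' : Fin n → moderateNum := fun k => ⟨_, hvm k⟩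
    let M : Fin n → moderateNum := fun k => ⟨_, hm j k⟩
    change ∑ k, Ideal.Quotient.mk negligibleNum (M k) * Ideal.Quotient.mk negligibleNum (v' k) = 0
    simp only [← map_mul, ← map_sum]
    rw [Ideal.Quotient.eq_zero_iff_mem]
    have hval : (∑ k, M k * v' k).1 = fun ε => (R ε *ᵥ v ε) j := by
      funext ε
      simp [M, v', mulVec, dotProduct]
    change NegligibleNum (∑ k, M k * v' k).1
    rw [hval]
    intro p
    refine OEps.mono (q := p.toNat) ⟨1, (hi p.toNat).mono fun ε h => ?_⟩ (Int.self_le_toNat p)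
    rw [zpow_natCast, one_mul]
    beta_reduce
    by_cases hε : ε ∈ S
    · have h1 := congrFun ((hs ε).mulVec_eigenvectorBasis (i ε)) j
      have h2 : (R ε *ᵥ v ε) j =
          (hs ε).eigenvalues (i ε) * (hs ε).eigenvectorBasis (i ε) j := by
        simpa only [v, if_pos hε, Pi.smul_apply, smul_eq_mul] using h1
      rw [h2, abs_mul]
      calc _ ≤ |(hs ε).eigenvalues (i ε)| * 1 := by gcongr; exact hle ε j
        _ ≤ _ := by rw [mul_one]; exact (h hε).le
    · have h2 : v ε = 0 := by simp only [v, if_neg hε]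
      rw [h2, mulVec_zero, Pi.zero_apply, abs_zero]
      exact (pow_pos ε.2.1 _).le
  have hneg : ∀ k, NegligibleNum fun ε => v ε k := fun k =>
    (GenReal.ofNet_eq_zero_iff (hvm k)).1 (congrFun hz k)
  have hsmall : ∀ᶠ ε : Eps in epsZero, ∀ k, |v ε k| ≤ ε := by
    rw [eventually_all]
    intro k
    simpa only [zpow_one] using (hneg k 2).eventually_le (p := 1) (by norm_num)
  -- `ε < 1 / (n + 1)` gives `n * ε^2 < 1`, contradicting the unit sum of squares.
  obtain ⟨ε, hεS, h1, h2⟩ := (hS.and_eventually (hsmall.and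
    (eventually_lt_epsZero (δ := 1 / ((n : ℝ) + 1)) (by positivity)))).exists
  have h3 : v ε = (hs ε).eigenvectorBasis (i ε) := by simp only [v, if_pos hεS]
  have h4 : ∑ k, v ε k ^ 2 = 1 := by
    have := EuclideanSpace.norm_sq_eq ((hs ε).eigenvectorBasis (i ε))
    rw [(hs ε).eigenvectorBasis.norm_eq_one] at this
    simpa [h3] using this.symm
  have h5 : ∑ k, v ε k ^ 2 ≤ ∑ _k : Fin n, (ε : ℝ) ^ 2 :=
    Finset.sum_le_sum fun k _ => sq_le_sq' (abs_le.1 (h1 k)).1 (abs_le.1 (h1 k)).2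
  rw [h4, Finset.sum_const, Finset.card_univ, Fintype.card_fin, nsmul_eq_mul] at h5
  rw [lt_div_iff₀ (by positivity)] at h2
  have hε := ε.2.1
  have hε1 := ε.2.2
  have hn : (0 : ℝ) ≤ n := n.cast_nonneg
  nlinarith [mul_nonneg hn hε.le]

lemma StrictlyPosNet.not_neg {a : Eps → ℝ} (ha : StrictlyPosNet a)
    (h : StrictlyPosNet fun ε => -a ε) : False := by
  obtain ⟨m, hm⟩ := ha
  obtain ⟨k, hk⟩ := h
  obtain ⟨ε, h1, h2⟩ := (hm.and hk).exists
  linarith [pow_pos ε.2.1 m, pow_pos ε.2.1 k]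

/-- A matrix over the generalized numbers has index `1` if it has a symmetric representative with
exactly one negative eigenvalue and eigenvalues bounded away from zero by a power of `ε`. -/
lemma matrixHasIndex_one {n : ℕ} {A : Matrix (Fin n) (Fin n) GenReal}
    {R : Eps → Matrix (Fin n) (Fin n) ℝ} (hs : ∀ ε, (R ε).IsHermitian)
    (hm : ∀ i k, ModerateNum fun ε => R ε i k)
    (hA : ∀ i k, GenReal.ofNet (fun ε => R ε i k) (hm i k) = A i k)
    (h1 : ∀ᶠ ε in epsZero, {i | (hs ε).eigenvalues i < 0}.ncard = 1) {m : ℕ}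
    (h2 : ∀ᶠ ε : Eps in epsZero, ∀ i, (ε : ℝ) ^ m ≤ |(hs ε).eigenvalues i|) :
    MatrixHasIndex A 1 := by
  -- The very reindexing by which `eigenvalues` is defined from the ordered `eigenvalues₀`.
  let σ : Fin n ≃ Fin (Fintype.card (Fin n)) :=
    (Fintype.equivOfCardEq (Fintype.card_fin _)).symm
  have hσ : ∀ ε k, (hs ε).eigenvalues₀ k = (hs ε).eigenvalues (σ.symm k) := fun ε k =>
    (congrArg (hs ε).eigenvalues₀ (σ.apply_symm_apply k)).symm
  have hcard : 0 < Fintype.card (Fin n) := by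
    obtain ⟨ε, hε⟩ := h1.exists
    obtain ⟨i, -⟩ := Set.nonempty_of_ncard_ne_zero (hε.trans_ne one_ne_zero)
    exact Fintype.card_pos_iff.2 ⟨i⟩
  -- `eigenvalues₀` is antitone, so the only negative eigenvalue sits at the last position, the same
  -- for all small `ε`.
  let l : Fin (Fintype.card (Fin n)) := ⟨Fintype.card (Fin n) - 1, by lia⟩
  have hlast : ∀ k, k ≤ l := fun k => by
    rw [Fin.le_def]
    have := k.2
    simp only [l]
    lia
  have hiff : ∀ᶠ ε in epsZero, ∀ k, (hs ε).eigenvalues₀ k < 0 ↔ k = l := by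
    filter_upwards [h1] with ε hε
    obtain ⟨i, hi⟩ := Set.ncard_eq_one.1 hε
    have hi' : ∀ k, (hs ε).eigenvalues₀ k < 0 ↔ k = σ i := fun k => by
      rw [hσ, ← Equiv.symm_apply_eq]
      exact Set.ext_iff.1 hi (σ.symm k)
    have hl : l = σ i := (hi' l).1
      (((hs ε).eigenvalues₀_antitone (hlast (σ i))).trans_lt ((hi' (σ i)).2 rfl))
    rw [hl]
    exact hi'
  have h2' : ∀ᶠ ε : Eps in epsZero, ∀ k, (ε : ℝ) ^ m ≤ |(hs ε).eigenvalues₀ k| :=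
    h2.mono fun ε h k => by rw [hσ]; exact h _
  have hneg : StrictlyPosNet fun ε => -(hs ε).eigenvalues₀ l := by
    refine ⟨m, ?_⟩
    filter_upwards [hiff, h2'] with ε h3 h4
    rw [← abs_of_neg ((h3 l).2 rfl)]
    exact h4 l
  have hpos : ∀ k ≠ l, StrictlyPosNet fun ε => (hs ε).eigenvalues₀ k := fun k hk => by
    refine ⟨m, ?_⟩
    filter_upwards [hiff, h2'] with ε h3 h4
    rw [← abs_of_nonneg (not_lt.1 fun h => hk ((h3 k).1 h))]
    exact h4 k
  have e1 : {k | StrictlyPosNet fun ε => -(hs ε).eigenvalues₀ k} = {l} := by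
    ext k
    refine ⟨fun h => ?_, fun h => ?_⟩
    · by_contra hk
      exact (hpos k hk).not_neg h
    · rw [mem_singleton_iff] at h
      rw [h]
      exact hneg
  have e2 : {k | StrictlyPosNet fun ε => (hs ε).eigenvalues₀ k} = {l}ᶜ := by
    ext k
    refine ⟨fun h hk => ?_, fun h => hpos k h⟩
    rw [mem_singleton_iff] at hk
    rw [hk] at h
    exact StrictlyPosNet.not_neg h hneg
  refine ⟨R, hs, hm, hA, ?_, ?_⟩
  · rw [e1, e2, add_comm, Set.ncard_add_ncard_compl, Nat.card_fin, Fintype.card_fin]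
  · rw [e1, Set.ncard_singleton]

/-- In an orthogonal basis the form is a weighted sum of squares with weights `B (v i) (v i)`;
Sylvester's law counts the negative ones. -/
lemma sigNeg_toQuadraticMap_eq_ncard {V ι : Type*} [AddCommGroup V] [Module ℝ V] [Fintype ι]
    {B : LinearMap.BilinForm ℝ V} (hB : B.IsSymm) (v : Module.Basis ι ℝ V)
    (hv : ∀ i j, i ≠ j → B (v i) (v j) = 0) :
    sigNeg (LinearMap.BilinMap.toQuadraticMap B) = {i | B (v i) (v i) < 0}.ncard := by
  classical
  have h1 : (QuadraticMap.associated (R := ℝ) (LinearMap.BilinMap.toQuadraticMap B)).IsOrthoᵢ v := by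
    rw [QuadraticMap.associated_left_inverse ℝ hB.eq]
    exact fun i j hij => hv i j hij
  have h2 := QuadraticMap.basisRepr_eq_of_iIsOrtho _ v h1
  exact QuadraticForm.sigNeg_of_equiv_weightedSumSquares
    ⟨h2 ▸ QuadraticMap.isometryEquivBasisRepr _ v⟩

/-! ### Signature of the point values of a metric -/

section Manifold

set_option linter.unusedSectionVars false

variable {n : ℕ} {X : Type*} [TopologicalSpace X] [ChartedSpace (EuclideanSpace ℝ (Fin n)) X]
  [IsManifold (𝓡 n) ∞ X]

/-- The coefficient matrix at `y` of the local expression of a tensor field. -/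
def coeffMatrix (φ : Chart n X) (g : SmoothT02 n X) (y : Euc n) : Matrix (Fin n) (Fin n) ℝ :=
  Matrix.of fun i j => locT02 φ g y (EuclideanSpace.single i 1) (EuclideanSpace.single j 1)

open Matrix in
lemma locT02_eq_dotProduct (φ : Chart n X) (g : SmoothT02 n X) (y v w : Euc n) :
    locT02 φ g y v w = v ⬝ᵥ coeffMatrix φ g y *ᵥ w := by
  rw [locT02_eq_sum]
  simp only [dotProduct, mulVec, coeffMatrix, Matrix.of_apply, Finset.mul_sum, mul_assoc]

lemma coeffMatrix_isHermitian (φ : Chart n X) {g : SmoothT02 n X} {y : Euc n}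
    (h : (SmoothT02.form g (φ.1.symm y)).IsSymm) : (coeffMatrix φ g y).IsHermitian := by
  refine Matrix.IsHermitian.ext fun i j => ?_
  exact h.eq _ _

open Matrix in
/-- The index of a metric at a point is the number of negative eigenvalues of its coefficient
matrix in a chart. -/
lemma sigNeg_form_eq_ncard (φ : Chart n X) {g : SmoothT02 n X} {y : Euc n} (hy : y ∈ φ.1.target)
    (h : (SmoothT02.form g (φ.1.symm y)).IsSymm) :
    sigNeg (LinearMap.BilinMap.toQuadraticMap (SmoothT02.form g (φ.1.symm y))) =
      {i | (coeffMatrix_isHermitian φ h).eigenvalues i < 0}.ncard := by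
  have hm : φ.1.MDifferentiable (𝓡 n) (𝓡 n) :=
    ⟨(contMDiffOn_of_mem_maximalAtlas φ.2).mdifferentiableOn (by simp),
      (contMDiffOn_symm_of_mem_maximalAtlas φ.2).mdifferentiableOn (by simp)⟩
  set hH := coeffMatrix_isHermitian φ h
  -- The differential of the inverse chart carries the eigenbasis to a `g`-orthogonal basis of the
  -- tangent space, with the eigenvalues as diagonal entries.
  let A : Euc n ≃ₗ[ℝ] TangentSpace (𝓡 n) (φ.1.symm y) := (hm.symm.mfderiv hy).toLinearEquiv
  let v : Module.Basis (Fin n) ℝ (TangentSpace (𝓡 n) (φ.1.symm y)) :=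
    hH.eigenvectorBasis.toBasis.map A
  have hv : ∀ i j, SmoothT02.form g (φ.1.symm y) (v i) (v j) =
      if i = j then hH.eigenvalues i else 0 := by
    intro i j
    have h1 : SmoothT02.form g (φ.1.symm y) (v i) (v j) =
        locT02 φ g y (hH.eigenvectorBasis i) (hH.eigenvectorBasis j) := by
      simp only [v, Module.Basis.map_apply, OrthonormalBasis.coe_toBasis]
      rfl
    have h2 := orthonormal_iff_ite.1 hH.eigenvectorBasis.orthonormal j i
    rw [EuclideanSpace.inner_eq_star_dotProduct] at h2
    rw [h1, locT02_eq_dotProduct, hH.mulVec_eigenvectorBasis, dotProduct_smul]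
    simp only [star_trivial] at h2
    rw [h2]
    by_cases hij : i = j
    · subst hij; simp
    · simp [hij, Ne.symm hij]
  rw [sigNeg_toQuadraticMap_eq_ncard h v fun i j hij => by rw [hv, if_neg hij]]
  simp [hv]

open Matrix in
-- Nondegeneracy of the point value keeps the eigenvalues away from zero; the representative of
-- index 1 near the net supplies the count of negative ones. Neither suffices alone.
theorem GenT02.IsLorentzian.isLorentzianForm_value [T2Space X] {g : GenT02 n X}
    (hg : g.IsLorentzian) (φ : Chart n X) (x : GenPoint φ.1.target) :
    IsLorentzianForm (g.value φ x) := by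
  classical
  have : LocallyCompactSpace X := ChartedSpace.locallyCompactSpace (Euc n) X
  refine ⟨(hg.1 φ x).1, Pi.basisFun GenReal (Fin n), ?_⟩
  have hker : ∀ v : Fin n → GenReal, g.valueMatrix φ x *ᵥ v = 0 → v = 0 := fun v hv =>
    (hg.1 φ x).2.2 v fun w => by
      rw [GenT02.value, Matrix.toBilin'_apply', hv, dotProduct_zero]
  have hmat : (Matrix.of fun i k => g.value φ x (Pi.basisFun GenReal (Fin n) i)
      (Pi.basisFun GenReal (Fin n) k)) = g.valueMatrix φ x := by
    ext i k
    simp [GenT02.value, Pi.basisFun_apply, Matrix.toBilin'_single]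
  rw [hmat]
  induction x using Quotient.inductionOn with | _ y
  obtain ⟨K, hK, hc, hy⟩ := y.compactly_supported
  obtain ⟨L, hL, hKL⟩ := exists_compact_superset
    (hc.image_of_continuousOn (φ.1.continuousOn_symm.mono hK))
  obtain ⟨r, rfl, hr⟩ := hg.2 (interior L) isOpen_interior
    (hL.of_isClosed_subset isClosed_closure
      (closure_minimal interior_subset hL.isClosed))
  -- Symmetry is required at every `ε`, but is known only for small `ε`; the default `0` alters the
  -- representative by a negligible net.
  let R : Eps → Matrix (Fin n) (Fin n) ℝ := fun ε =>
    if (coeffMatrix φ (r.1 ε) (y.pt ε)).IsHermitian then coeffMatrix φ (r.1 ε) (y.pt ε) else 0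
  have hs : ∀ ε, (R ε).IsHermitian := fun ε => by
    by_cases h : (coeffMatrix φ (r.1 ε) (y.pt ε)).IsHermitian
    · simpa only [R, if_pos h] using h
    · simp only [R, if_neg h]; exact isHermitian_zero
  have hR : ∀ᶠ ε in epsZero, ∃ h : (SmoothT02.form (r.1 ε) (φ.1.symm (y.pt ε))).IsSymm,
      R ε = coeffMatrix φ (r.1 ε) (y.pt ε) ∧
        {i | (coeffMatrix_isHermitian φ h).eigenvalues i < 0}.ncard = 1 := by
    filter_upwards [hr, hy] with ε h1 h2
    obtain ⟨h3, -, h4⟩ := h1 _ (hKL (mem_image_of_mem _ h2))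
    exact ⟨h3, if_pos (coeffMatrix_isHermitian φ h3),
      (sigNeg_form_eq_ncard φ (y.mem ε) h3).symm.trans h4⟩
  have hneg : ∀ i k, NegligibleNum ((fun ε => R ε i k) - valueNetT02 φ r.1 y i k) :=
    fun i k p => ⟨0, hR.mono fun ε ⟨_, h, _⟩ => by
      simp only [Pi.sub_apply, h]
      simp [coeffMatrix, valueNetT02]⟩
  have hm : ∀ i k, ModerateNum fun ε => R ε i k := fun i k => by
    have := moderateNum.add_mem (show _ ∈ moderateNum from ⟨0, hneg i k 0⟩)
      (valueNetT02_moderate φ r y i k)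
    rwa [sub_add_cancel] at this
  have hA : ∀ i k, GenReal.ofNet (fun ε => R ε i k) (hm i k) =
      GenT02.valueMatrix (Submodule.Quotient.mk r : GenT02 n X) φ (Quotient.mk _ y) i k :=
    fun i k => GenReal.ofNet_eq _ (valueNetT02_moderate φ r y i k) (hneg i k)
  have hmatR : (Matrix.of fun i k => GenReal.ofNet (fun ε => R ε i k) (hm i k)) =
      GenT02.valueMatrix (Submodule.Quotient.mk r : GenT02 n X) φ (Quotient.mk _ y) :=
    Matrix.ext hA
  obtain ⟨m, h2⟩ := exists_pow_le_abs_eigenvalues hs hm (by rw [hmatR]; exact hker)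
  refine matrixHasIndex_one hs hm hA (hR.mono ?_) h2
  rintro ε ⟨h, h3, h4⟩
  simpa only [h3] using h4

end Manifold

end Colombeau

end

/-! ### Assembly of the theorem -/

theorem mainTheorem9 {n : ℕ} {X : Type*} [TopologicalSpace X] [T2Space X] [ParacompactSpace X]
    [ChartedSpace (EuclideanSpace ℝ (Fin n)) X] [IsManifold (𝓡 n) ∞ X]
    (g : Colombeau.GenT02 n X) (hg : g.IsLorentzian) (ξ : Colombeau.GenVF n X) :
    -- every point value of `g` in a chart is a symmetric bilinear form of Lorentzian signature
    (∀ (φ : Colombeau.Chart n X) (x : Colombeau.GenPoint φ.1.target),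
      Colombeau.IsLorentzianForm (g.value φ x)) ∧
    -- time-like
    ((∀ (φ : Colombeau.Chart n X) (x : Colombeau.GenPoint φ.1.target),
      Colombeau.IsTimelike (g.value φ x) (ξ.value φ x)) ↔ (g.pair ξ ξ).IsNeg) ∧
    -- space-like
    ((∀ (φ : Colombeau.Chart n X) (x : Colombeau.GenPoint φ.1.target),
      Colombeau.IsSpacelike (g.value φ x) (ξ.value φ x)) ↔ (g.pair ξ ξ).IsPos) ∧
    -- null
    ((∀ (φ : Colombeau.Chart n X) (x : Colombeau.GenPoint φ.1.target),
      g.value φ x (ξ.value φ x) (ξ.value φ x) = 0) ↔ g.pair ξ ξ = 0) ∧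
    ((∀ (φ : Colombeau.Chart n X) (x : Colombeau.GenPoint φ.1.target),
      Colombeau.IsNull (g.value φ x) (ξ.value φ x)) ↔
      g.pair ξ ξ = 0 ∧ ∀ (φ : Colombeau.Chart n X) (x : Colombeau.GenPoint φ.1.target),
        ξ.value φ x = 0 ∨ Colombeau.IsFree (ξ.value φ x)) := by
  induction g using Submodule.Quotient.induction_on with | _ g
  induction ξ using Submodule.Quotient.induction_on with | _ ξ
  have hpair : Colombeau.GenT02.pair (Submodule.Quotient.mk g) (Submodule.Quotient.mk ξ)
      (Submodule.Quotient.mk ξ) = Ideal.Quotient.mk (Colombeau.negligibleFun n X)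
        (Colombeau.pairNet g ξ ξ) := rfl
  have hnull : (∀ (φ : Colombeau.Chart n X) (x : Colombeau.GenPoint φ.1.target),
      Colombeau.GenT02.value (Submodule.Quotient.mk g) φ x
        (Colombeau.GenVF.value (Submodule.Quotient.mk ξ) φ x)
        (Colombeau.GenVF.value (Submodule.Quotient.mk ξ) φ x) = 0) ↔
      Colombeau.GenT02.pair (Submodule.Quotient.mk g) (Submodule.Quotient.mk ξ)
        (Submodule.Quotient.mk ξ) = 0 := by
    rw [hpair, Colombeau.GenFun.mk_eq_zero_iff]
    refine forall_congr' fun φ => Quotient.forall.trans (forall_congr' fun y => ?_)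
    rw [Colombeau.GenT02.value_apply_value, Colombeau.GenReal.ofNet_eq_zero_iff]
  refine ⟨fun φ x => hg.isLorentzianForm_value φ x, ?_, ?_, hnull, ?_⟩
  · rw [hpair, Colombeau.GenFun.isNeg_mk_iff]
    refine forall_congr' fun φ => Quotient.forall.trans (forall_congr' fun y => ?_)
    rw [Colombeau.IsTimelike, Colombeau.GenT02.value_apply_value, Colombeau.GenReal.isNeg_ofNet_iff]
  · rw [hpair, Colombeau.GenFun.isPos_mk_iff]
    refine forall_congr' fun φ => Quotient.forall.trans (forall_congr' fun y => ?_)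
    rw [Colombeau.IsSpacelike, Colombeau.GenT02.value_apply_value,
      Colombeau.GenReal.isPos_ofNet_iff]
  -- Both alternatives in nullness give `b(u, u) = 0`, so the first conjunct can be tested
  -- pointwise.
  · rw [← hnull]
    refine ⟨fun h => ⟨fun φ x => ?_, fun φ x => (h φ x).imp_right And.left⟩,
      fun h φ x => (h.2 φ x).imp_right fun hf => ⟨hf, h.1 φ x⟩⟩
    rcases h φ x with h0 | h0
    · rw [h0, map_zero]
    · exact h0.2
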